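/- Let $\Bbbk=\mathbb{R}$ or $\Bbbk=\mathbb{C}$. Manifolds are Hausdorff, second countable, and finite-dimensional; everything is smooth if $\Bbbk=\mathbb{R}$ and holomorphic if $\Bbbk=\mathbb{C}$. Let $G$ be a Lie group over $\Bbbk$ with Lie algebra $\mathfrak{g}$, acting on a manifold $M$, and for $x\in\mathfrak{g}$ let $(x_M)_p=\frac{d}{dt}\big|_{t=0}\exp(-tx)\cdot p$ be its generating vector field. Let $(M,\omega,\mu)$ be a Hamiltonian $G$-space: $\omega$ is a $G$-invariant symplectic form on $M$ (a closed $2$-form that is non-degenerate at every point), and $\mu:M\to\mathfrak{g}^*$ is a map that is equivariant for the coadjoint action and satisfies $\omega(x_M,\cdot)=-\mathrm{d}\mu^x$ for all $x\in\mathfrak{g}$, where $\mu^x(p)=\mu(p)(x)$. Let $\xi\in\mathfrak{g}^*$, let $G_\xi\subset G$ be its stabilizer under the coadjoint action, and let $\mathfrak{g}_\xi=\{x\in\mathfrak{g}:(x_{\mathfrak{g}^*})_\xi=0\}$ be the Lie algebra of $G_\xi$. Suppose that the action of $G_\xi$ on $\mu^{-1}(\xi)$ is locally free, i.e. for every $p\in\mu^{-1}(\xi)$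 the only $x\in\mathfrak{g}_\xi$ with $(x_M)_p=0$ is $x=0$. Then $\mu^{-1}(\xi)$ is an embedded submanifold of $M$. Let $j:\mu^{-1}(\xi)\to M$ be the inclusion and $\pi:\mu^{-1}(\xi)\to\mu^{-1}(\xi)/G_\xi$ the quotient map. If $\mu^{-1}(\xi)/G_\xi$ is a manifold, i.e. it carries a manifold structure for which $\pi$ is a submersion, then there exists a unique symplectic form $\overline{\omega}_\xi$ on $\mu^{-1}(\xi)/G_\xi$ satisfying $j^*\omega=\pi^*\overline{\omega}_\xi$. -/

import Mathlib

open scoped Manifold ContDiff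

noncomputable section

namespace HamiltonianReduction

/-! Throughout, `𝕜` is `ℝ` or `ℂ`, and manifolds are modelled on finite-dimensional normed `𝕜`-vector
spaces. Over `ℂ`, being of class `C^∞` means being holomorphic. -/

section Forms

variable {𝕜 : Type*} [RCLike 𝕜]
  {E : Type*} [NormedAddCommGroup E] [NormedSpace 𝕜 E]
  {M : Type*} [TopologicalSpace M] [ChartedSpace E M]
  {E' : Type*} [NormedAddCommGroup E'] [NormedSpace 𝕜 E']
  {M' : Type*} [TopologicalSpace M'] [ChartedSpace E' M']

/-- Not necessarily smooth 2-forms on `M`: an alternating bilinear form on every tangent space. -/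
abbrev TwoForm (𝕜 : Type*) [RCLike 𝕜] (E : Type*) [NormedAddCommGroup E] [NormedSpace 𝕜 E]
    (M : Type*) [TopologicalSpace M] [ChartedSpace E M] :=
  (p : M) → TangentSpace 𝓘(𝕜, E) p [⋀^Fin 2]→L[𝕜] 𝕜

/-- The pullback `f^* Ω` of a 2-form `Ω` along a map `f`, given by
`(f^* Ω)_p (v, w) = Ω_{f p} (df_p v, df_p w)`. -/
def TwoForm.pullback (f : M → M') (Ω : TwoForm 𝕜 E' M') : TwoForm 𝕜 E M :=
  fun p => (Ω (f p)).compContinuousLinearMap (mfderiv 𝓘(𝕜, E) 𝓘(𝕜, E') f p)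

/-- The expression of a 2-form in the preferred chart around `x₀`: the pullback along the inverse
of the chart. It is meaningful on the target of the chart, an open subset of `E`. -/
def TwoForm.inChart (Ω : TwoForm 𝕜 E M) (x₀ : M) : E → E [⋀^Fin 2]→L[𝕜] 𝕜 :=
  TwoForm.pullback (E := E) (M := E) (extChartAt 𝓘(𝕜, E) x₀).symm Ω

/-- A symplectic form: a smooth (holomorphic) closed 2-form which is non-degenerate
at every point. -/
structure IsSymplectic (Ω : TwoForm 𝕜 E M) : Prop where
  smooth : ∀ x₀ : M, ContDiffOn 𝕜 ∞ (Ω.inChart x₀) (extChartAt 𝓘(𝕜, E) x₀).target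
  closed : ∀ x₀ : M, ∀ y ∈ (extChartAt 𝓘(𝕜, E) x₀).target, extDeriv (Ω.inChart x₀) y = 0
  nondegenerate : ∀ (p : M) (v : TangentSpace 𝓘(𝕜, E) p),
    (∀ w : TangentSpace 𝓘(𝕜, E) p, Ω p ![v, w] = 0) → v = 0

/-- `X` is the Hamiltonian vector field of `f`, that is `Ω(X, ·) = - df`. -/
def IsHamiltonianVectorField (Ω : TwoForm 𝕜 E M) (f : M → 𝕜)
    (X : (p : M) → TangentSpace 𝓘(𝕜, E) p) : Prop :=
  ∀ (p : M) (v : TangentSpace 𝓘(𝕜, E) p),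
    Ω p ![X p, v] = -(mfderiv 𝓘(𝕜, E) 𝓘(𝕜, 𝕜) f p v : 𝕜)

end Forms

section Coadjoint

variable {𝕜 : Type*} [RCLike 𝕜]
  {EG : Type*} [NormedAddCommGroup EG] [NormedSpace 𝕜 EG]
  {G : Type*} [TopologicalSpace G] [ChartedSpace EG G] [Group G]

/-- The Lie algebra `𝔤 = T_1 G` of `G` is, as a vector space, the model space `EG` of `G`;
so `EG →L[𝕜] 𝕜` is the dual `𝔤^*`. `Ad g` is the derivative at `1` of `h ↦ g h g⁻¹`. -/
def Ad (𝕜 : Type*) [RCLike 𝕜] {EG : Type*} [NormedAddCommGroup EG] [NormedSpace 𝕜 EG]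
    {G : Type*} [TopologicalSpace G] [ChartedSpace EG G] [Group G] (g : G) : EG →L[𝕜] EG :=
  mfderiv 𝓘(𝕜, EG) 𝓘(𝕜, EG) (fun h : G => g * h * g⁻¹) 1

/-- The coadjoint action `Ad^*_g ξ = ξ ∘ Ad_{g⁻¹}`. -/
def coAd (g : G) (ξ : EG →L[𝕜] 𝕜) : EG →L[𝕜] 𝕜 := ξ.comp (Ad 𝕜 g⁻¹)

theorem Ad_one : Ad 𝕜 (1 : G) = ContinuousLinearMap.id 𝕜 EG := by
  have h : (fun h : G => 1 * h * (1 : G)⁻¹) = id := by ext; simp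
  unfold Ad
  rw [h]
  exact mfderiv_id

theorem Ad_mul [LieGroup 𝓘(𝕜, EG) ∞ G] (g h : G) :
    Ad 𝕜 (g * h) = (Ad 𝕜 g : EG →L[𝕜] EG).comp (Ad 𝕜 h) := by
  have hd : ∀ (k x : G), MDifferentiableAt 𝓘(𝕜, EG) 𝓘(𝕜, EG) (fun y : G => k * y * k⁻¹) x := by
    intro k x
    have h1 : ContMDiff 𝓘(𝕜, EG) 𝓘(𝕜, EG) ∞ (fun y : G => k * y * k⁻¹) :=
      (contMDiff_const.mul contMDiff_id).mul contMDiff_const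
    exact h1.mdifferentiableAt (by simp)
  have hc : (fun y : G => g * h * y * (g * h)⁻¹)
      = (fun y : G => g * y * g⁻¹) ∘ (fun y : G => h * y * h⁻¹) := by
    ext y; simp [mul_assoc]
  have h1 : h * 1 * h⁻¹ = 1 := by simp
  have key := mfderiv_comp (I := 𝓘(𝕜, EG)) (I' := 𝓘(𝕜, EG)) (I'' := 𝓘(𝕜, EG)) (1 : G)
    (hd g (h * 1 * h⁻¹)) (hd h 1)
  rw [← hc] at key
  have h2 : (mfderiv 𝓘(𝕜, EG) 𝓘(𝕜, EG) (fun y : G => g * y * g⁻¹) (h * 1 * h⁻¹) : EG →L[𝕜] EG)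
      = (mfderiv 𝓘(𝕜, EG) 𝓘(𝕜, EG) (fun y : G => g * y * g⁻¹) 1 : EG →L[𝕜] EG) := by
    rw [h1]
  unfold Ad
  rw [← h2]
  exact key

theorem coAd_one (ξ : EG →L[𝕜] 𝕜) : coAd (1 : G) ξ = ξ := by
  simp [coAd, Ad_one]

theorem coAd_mul [LieGroup 𝓘(𝕜, EG) ∞ G] (g h : G) (ξ : EG →L[𝕜] 𝕜) :
    coAd (g * h) ξ = coAd g (coAd h ξ) := by
  simp [coAd, Ad_mul, ContinuousLinearMap.comp_assoc]

/-- The stabilizer `G_ξ` of `ξ ∈ 𝔤^*` under the coadjoint action. -/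
def coadjointStabilizer (G : Type*) [TopologicalSpace G] [ChartedSpace EG G] [Group G]
    [LieGroup 𝓘(𝕜, EG) ∞ G] (ξ : EG →L[𝕜] 𝕜) : Subgroup G where
  carrier := {g | coAd g ξ = ξ}
  one_mem' := coAd_one ξ
  mul_mem' := by
    intro g h hg hh
    change coAd (g * h) ξ = ξ
    rw [coAd_mul, show coAd h ξ = ξ from hh, show coAd g ξ = ξ from hg]
  inv_mem' := by
    intro g hg
    change coAd g⁻¹ ξ = ξ
    have hg' : coAd g ξ = ξ := hg
    calc coAd g⁻¹ ξ = coAd g⁻¹ (coAd g ξ) := by rw [hg']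
      _ = ξ := by rw [← coAd_mul, inv_mul_cancel, coAd_one]

/-- The Lie algebra `𝔤_ξ` of `G_ξ`: those `x ∈ 𝔤` whose generating vector field on `𝔤^*`
(see `generatingVectorField`) vanishes at `ξ`. -/
def coadjointStabilizerAlgebra (G : Type*) [TopologicalSpace G] [ChartedSpace EG G] [Group G]
    (ξ : EG →L[𝕜] 𝕜) : Set EG :=
  {x | (mfderiv 𝓘(𝕜, EG) 𝓘(𝕜, EG →L[𝕜] 𝕜) (fun g : G => coAd g ξ) 1 : EG →L[𝕜] EG →L[𝕜] 𝕜) x = 0}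

end Coadjoint

section Hamiltonian

variable {𝕜 : Type*} [RCLike 𝕜]
  {EG : Type*} [NormedAddCommGroup EG] [NormedSpace 𝕜 EG]
  {E : Type*} [NormedAddCommGroup E] [NormedSpace 𝕜 E]

/-- The generating vector field `(x_M)_p = d/dt|_{t = 0} exp(-t x) • p` of `x ∈ 𝔤`, that is, minus
the derivative at `1` of the orbit map `g ↦ g • p` in the direction `x`. -/
def generatingVectorField (𝕜 : Type*) [RCLike 𝕜]
    {EG : Type*} [NormedAddCommGroup EG] [NormedSpace 𝕜 EG]
    {E : Type*} [NormedAddCommGroup E] [NormedSpace 𝕜 E]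
    (G : Type*) [TopologicalSpace G] [ChartedSpace EG G] [Group G]
    {M : Type*} [TopologicalSpace M] [ChartedSpace E M] [MulAction G M]
    (x : EG) (p : M) : TangentSpace 𝓘(𝕜, E) p :=
  -(mfderiv 𝓘(𝕜, EG) 𝓘(𝕜, E) (fun g : G => g • p) 1 : EG →L[𝕜] E) x

/-- `(M, Ω, μ)` is a Hamiltonian `G`-space: `Ω` is a `G`-invariant symplectic form, and `μ` is a
smooth `G`-equivariant map such that, for all `x ∈ 𝔤`, `x_M` is the Hamiltonian vector field of
`μ^x = ⟨μ, x⟩`. -/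
structure IsHamiltonianSpace (G : Type*) [TopologicalSpace G] [ChartedSpace EG G] [Group G]
    {M : Type*} [TopologicalSpace M] [ChartedSpace E M] [MulAction G M]
    (Ω : TwoForm 𝕜 E M) (μ : M → EG →L[𝕜] 𝕜) : Prop where
  symplectic : IsSymplectic Ω
  invariant : ∀ g : G, TwoForm.pullback (fun p : M => g • p) Ω = Ω
  smooth_moment : ContMDiff 𝓘(𝕜, E) 𝓘(𝕜, EG →L[𝕜] 𝕜) ∞ μ
  equivariant : ∀ (g : G) (p : M), μ (g • p) = coAd g (μ p)
  moment : ∀ x : EG,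
    IsHamiltonianVectorField Ω (fun p => μ p x) (fun p => generatingVectorField 𝕜 G x p)

/-- The action of `G_ξ` on `μ⁻¹(ξ)` is locally free: for every `p ∈ μ⁻¹(ξ)`, the Lie algebra
`(𝔤_ξ)_p = {x ∈ 𝔤_ξ : (x_M)_p = 0}` of the stabilizer of `p` in `G_ξ` is trivial. -/
def IsLocallyFreeOnLevel (G : Type*) [TopologicalSpace G] [ChartedSpace EG G] [Group G]
    {M : Type*} [TopologicalSpace M] [ChartedSpace E M] [MulAction G M]
    (μ : M → EG →L[𝕜] 𝕜) (ξ : EG →L[𝕜] 𝕜) : Prop :=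
  ∀ p : M, μ p = ξ → ∀ x ∈ coadjointStabilizerAlgebra G ξ,
    generatingVectorField (E := E) 𝕜 G x p = 0 → x = 0

/-- The level set `μ⁻¹(ξ)`, with the subspace topology. -/
abbrev LevelSet {M : Type*} (μ : M → EG →L[𝕜] 𝕜) (ξ : EG →L[𝕜] 𝕜) : Type _ := ↥(μ ⁻¹' {ξ})

/-- Two points of `μ⁻¹(ξ)` are equivalent if they lie in the same `G_ξ`-orbit. -/
def levelSetoid (G : Type*) [TopologicalSpace G] [ChartedSpace EG G] [Group G]
    [LieGroup 𝓘(𝕜, EG) ∞ G] {M : Type*} [MulAction G M]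
    (μ : M → EG →L[𝕜] 𝕜) (ξ : EG →L[𝕜] 𝕜) : Setoid (LevelSet μ ξ) :=
  (MulAction.orbitRel (coadjointStabilizer G ξ) M).comap Subtype.val

/-- The quotient `μ⁻¹(ξ) / G_ξ`, with the quotient topology. -/
abbrev ReducedSpace (G : Type*) [TopologicalSpace G] [ChartedSpace EG G] [Group G]
    [LieGroup 𝓘(𝕜, EG) ∞ G] {M : Type*} [TopologicalSpace M] [MulAction G M]
    (μ : M → EG →L[𝕜] 𝕜) (ξ : EG →L[𝕜] 𝕜) : Type _ :=
  Quotient (levelSetoid G μ ξ)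

/-- The inclusion `j : μ⁻¹(ξ) → M`. -/
def levelInclusion {M : Type*} (μ : M → EG →L[𝕜] 𝕜) (ξ : EG →L[𝕜] 𝕜) : LevelSet μ ξ → M :=
  Subtype.val

/-- The quotient map `π : μ⁻¹(ξ) → μ⁻¹(ξ) / G_ξ`. -/
def levelProjection (G : Type*) [TopologicalSpace G] [ChartedSpace EG G] [Group G]
    [LieGroup 𝓘(𝕜, EG) ∞ G] {M : Type*} [TopologicalSpace M] [MulAction G M]
    (μ : M → EG →L[𝕜] 𝕜) (ξ : EG →L[𝕜] 𝕜) : LevelSet μ ξ → ReducedSpace G μ ξ :=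
  Quotient.mk (levelSetoid G μ ξ)

end Hamiltonian

end HamiltonianReduction

end

/-! The symplectic quotient at a level `ξ` of a moment map, for real and complex Lie groups.

*The level set.* If `Ω(x_M, ·) = -dμ^x`, then the annihilator of the range of `dμ_p` consists of the
`x ∈ 𝔤` with `(x_M)_p = 0`. By equivariance every such `x` lies in `𝔤_ξ` when `μ(p) = ξ`, so local
freeness of `G_ξ` makes `ξ` a regular value (`IsHamiltonianSpace.surjective_tderiv_moment`), and
the regular value theorem `exists_manifold_structure_level` applies. Moreover
`T_p μ⁻¹(ξ) = ker dμ_p` for every embedded structure (`exists_tderiv_eq_of_tderiv_eq_zero`).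

*The quotient.* A form descends, uniquely, along a surjective submersion `π` when it annihilates the
vertical vectors and is invariant under maps that permute the points of each fibre transitively
(`existsUnique_eq_pullback`). Here the maps are the translations by `G_ξ`. The form obtained is
locally the pullback of `Ω` along `j ∘ σ`, with `σ` a section of `π`, hence smooth and closed
(`isSymplectic_of_pullback_eq`). So everything reduces to `ker (j^* Ω)_p = ker dπ_p`.

*Kernel of `j^* Ω` ⊆ vertical vectors.* The symplectic orthogonal of `ker dμ_p` is the tangent space
`𝔤 · p` of the orbit, and `𝔤 · p ∩ ker dμ_p = 𝔤_ξ · p`. An element `x` of `𝔤_ξ`, which is defined as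
the kernel of a derivative, is the velocity at `1` of a curve in `G_ξ`, because `g ↦ Ad^*_g ξ` has
constant rank (`IsHamiltonianSpace.exists_curve_in_stabilizer`); and `π` is constant along the
translates of `p` by this curve. This avoids the exponential map and the closed subgroup theorem.

*Vertical vectors ⊆ kernel of `j^* Ω`.* The fibre of `π` through `p` is a submanifold, and as a set
a `G_ξ`-orbit. That its tangent vectors are tangent to the `G`-orbit needs the second countability
of `G`: by the Baire category theorem, an open piece of the fibre is contained in a compact piece
of the orbit, which is parametrised by an immersed piece of `G` (`exists_tangent_to_orbit`). This
gives the claim at one point of each fibre, and `G_ξ` carries it to the others.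
-/

noncomputable section

open scoped Manifold ContDiff Topology
open Set Filter

namespace HamiltonianReduction

/-! ### Calculus in finite-dimensional spaces -/

section Calculus

variable {𝕜 : Type*} [RCLike 𝕜]
  {V : Type*} [NormedAddCommGroup V] [NormedSpace 𝕜 V]
  {W : Type*} [NormedAddCommGroup W] [NormedSpace 𝕜 W]
  {X : Type*} [NormedAddCommGroup X] [NormedSpace 𝕜 X]

/-- Half the alternatization of a continuous bilinear map, as a continuous linear map; it is a left
inverse of the inclusion of alternating into bilinear maps, which lets smoothness of a map into the
former be tested in the latter. -/
def halfAlternatization (𝕜 : Type*) [RCLike 𝕜] (X : Type*) [NormedAddCommGroup X]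
    [NormedSpace 𝕜 X] :
    ContinuousMultilinearMap 𝕜 (fun _ : Fin 2 => X) 𝕜 →L[𝕜] X [⋀^Fin 2]→L[𝕜] 𝕜 :=
  LinearMap.mkContinuous
    { toFun := fun f => (2⁻¹ : 𝕜) • ContinuousMultilinearMap.alternatization f
      map_add' := fun f g => by simp
      map_smul' := fun c f => by
        ext v
        simp [ContinuousMultilinearMap.alternatization_apply_apply, Finset.mul_sum,
          Units.smul_def, mul_left_comm] }
    1 (fun f => by
      refine ContinuousAlternatingMap.opNorm_le_bound _ (by positivity) fun v => ?_
      have h1 : ‖f v‖ ≤ ‖f‖ * ∏ i, ‖v i‖ := f.le_opNorm v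
      have h2 : ‖f (v ∘ Equiv.swap 0 1)‖ ≤ ‖f‖ * ∏ i, ‖v i‖ := by
        refine (f.le_opNorm _).trans_eq ?_
        rw [← Equiv.prod_comp (Equiv.swap (0 : Fin 2) 1) (fun i => ‖v i‖)]
        rfl
      have h3 : ContinuousMultilinearMap.alternatization f v
          = f v - f (v ∘ Equiv.swap 0 1) := by
        rw [ContinuousMultilinearMap.alternatization_apply_apply]
        have hu : (Finset.univ : Finset (Equiv.Perm (Fin 2))) = {1, Equiv.swap 0 1} := by decide
        rw [hu, Finset.sum_pair (by decide)]
        simp [sub_eq_add_neg]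
      simp only [LinearMap.coe_mk, AddHom.coe_mk, ContinuousAlternatingMap.smul_apply, h3,
        norm_smul, norm_inv, RCLike.norm_ofNat, one_mul]
      have := norm_sub_le (f v) (f (v ∘ Equiv.swap 0 1))
      linarith)

theorem halfAlternatization_coe (f : X [⋀^Fin 2]→L[𝕜] 𝕜) :
    halfAlternatization 𝕜 X f.toContinuousMultilinearMap = f := by
  ext v
  have hu : (Finset.univ : Finset (Equiv.Perm (Fin 2))) = {1, Equiv.swap 0 1} := by decide
  have h : f (v ∘ Equiv.swap 0 1) = - f v := f.map_swap v (by decide)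
  change (2⁻¹ : 𝕜) • ContinuousMultilinearMap.alternatization f.toContinuousMultilinearMap v = f v
  rw [ContinuousMultilinearMap.alternatization_apply_apply, hu, Finset.sum_pair (by decide)]
  simp only [Equiv.Perm.sign_one, one_smul, Equiv.Perm.coe_one, Function.comp_id]
  change (2⁻¹ : 𝕜) • (f v + _ • f (v ∘ Equiv.swap 0 1)) = f v
  rw [h]
  simp
  ring

theorem contDiffAt_compContinuousLinearMap {n : ℕ∞ω} {Ω : V → W [⋀^Fin 2]→L[𝕜] 𝕜}
    {A : V → X →L[𝕜] W} {y : V} (hΩ : ContDiffAt 𝕜 n Ω y) (hA : ContDiffAt 𝕜 n A y) :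
    ContDiffAt 𝕜 n (fun v => (Ω v).compContinuousLinearMap (A v)) y := by
  have h1 : ContDiffAt 𝕜 n (fun v =>
      ContinuousMultilinearMap.compContinuousLinearMapContinuousMultilinear 𝕜
        (fun _ : Fin 2 => X) (fun _ : Fin 2 => W) 𝕜 (fun _ => A v)) y :=
    (ContinuousMultilinearMap.contDiff _).contDiffAt.comp y (contDiffAt_pi.2 fun _ => hA)
  have h2 : ContDiffAt 𝕜 n
      (fun v => ContinuousAlternatingMap.toContinuousMultilinearMapCLM 𝕜 (Ω v)) y :=
    (ContinuousLinearMap.contDiff _).contDiffAt.comp y hΩ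
  have h3 := (halfAlternatization 𝕜 X).contDiff.contDiffAt.comp y (h1.clm_apply h2)
  refine h3.congr_of_eventuallyEq (Eventually.of_forall fun v => ?_)
  exact (halfAlternatization_coe ((Ω v).compContinuousLinearMap (A v))).symm

/-- The inverse function theorem, on a whole neighbourhood. -/
theorem exists_openPartialHomeomorph_contDiffOn [CompleteSpace V] {U : Set V} (hU : IsOpen U)
    {f : V → W} {a : V} (ha : a ∈ U) (hf : ContDiffOn 𝕜 ∞ f U) (f' : V ≃L[𝕜] W)
    (hf' : HasFDerivAt f (f' : V →L[𝕜] W) a) :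
    ∃ T : OpenPartialHomeomorph V W, a ∈ T.source ∧ T.source ⊆ U ∧ (∀ y, T y = f y) ∧
      ContDiffOn 𝕜 ∞ T.symm T.target := by
  have hfa : ContDiffAt 𝕜 ∞ f a := hf.contDiffAt (hU.mem_nhds ha)
  set T₀ := hfa.toOpenPartialHomeomorph f hf' (by simp)
  set s : Set V := U ∩ fderiv 𝕜 f ⁻¹' (range ((↑) : (V ≃L[𝕜] W) → V →L[𝕜] W))
  have hs : IsOpen s :=
    (hf.continuousOn_fderiv_of_isOpen hU (by simp)).isOpen_inter_preimage hU
      ContinuousLinearEquiv.isOpen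
  have has : a ∈ s := ⟨ha, f', hf'.fderiv.symm⟩
  have hsrc : (T₀.restr s).source = T₀.source ∩ s := by
    rw [OpenPartialHomeomorph.restr_source, hs.interior_eq]
  refine ⟨T₀.restr s, ?_, ?_, fun y => rfl, ?_⟩
  · rw [hsrc]
    exact ⟨hfa.mem_toOpenPartialHomeomorph_source hf' (by simp), has⟩
  · rw [hsrc]
    exact fun y hy => hy.2.1
  · intro w hw
    have hmem := (T₀.restr s).map_target hw
    rw [hsrc] at hmem
    obtain ⟨-, hyU, e, he⟩ := hmem
    have hfy := hf.contDiffAt (hU.mem_nhds hyU)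
    refine ((T₀.restr s).contDiffAt_symm hw (f₀' := e) ?_ hfy).contDiffWithinAt
    rw [he]
    exact (hfy.differentiableAt (by simp)).hasFDerivAt

/-- A surjective linear map is, up to an isomorphism, the projection of a product; any space of the
right dimension can serve as the other factor. -/
theorem exists_equiv_prod_of_surjective [FiniteDimensional 𝕜 V] [FiniteDimensional 𝕜 W]
    [FiniteDimensional 𝕜 X] (f : V →L[𝕜] W) (hf : Function.Surjective f)
    (hd : Module.finrank 𝕜 V = Module.finrank 𝕜 X + Module.finrank 𝕜 W) :
    ∃ e : V ≃L[𝕜] X × W, ∀ x, (e x).2 = f x := by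
  have hker : Module.finrank 𝕜 (LinearMap.ker (f : V →ₗ[𝕜] W)) = Module.finrank 𝕜 X := by
    have h := LinearMap.finrank_range_add_finrank_ker (f : V →ₗ[𝕜] W)
    rw [LinearMap.range_eq_top.2 hf, finrank_top] at h
    omega
  obtain ⟨p, hp⟩ := (LinearMap.ker (f : V →ₗ[𝕜] W)).subtype.exists_leftInverse_of_injective
    (Submodule.ker_subtype _)
  let i := LinearEquiv.ofFinrankEq _ _ hker
  let L : V →ₗ[𝕜] X × W := ((i : _ →ₗ[𝕜] X) ∘ₗ p).prod (f : V →ₗ[𝕜] W)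
  have hL : Function.Injective L := by
    rw [← LinearMap.ker_eq_bot, LinearMap.ker_eq_bot']
    intro x hx
    have h1 : i (p x) = 0 := congrArg Prod.fst hx
    have h2 : f x = 0 := congrArg Prod.snd hx
    have h3 := LinearMap.congr_fun hp ⟨x, h2⟩
    simp only [LinearMap.coe_comp, Submodule.coe_subtype, Function.comp_apply,
      LinearMap.id_coe, id_eq] at h3
    rw [i.map_eq_zero_iff, h3] at h1
    exact congrArg Subtype.val h1
  refine ⟨(LinearEquiv.ofInjectiveOfFinrankEq L hL (by simpa using hd)).toContinuousLinearEquiv,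
    fun x => rfl⟩

/-- If `f` has injective derivative at `a`, it has a local left inverse there. -/
theorem exists_local_leftInverse [FiniteDimensional 𝕜 V] [FiniteDimensional 𝕜 W]
    {f : V → W} {a : V} (hf : ContDiffAt 𝕜 ∞ f a)
    (hinj : Function.Injective (fderiv 𝕜 f a)) :
    ∃ r : W → V, ContDiffAt 𝕜 ∞ r (f a) ∧ ∀ᶠ y in 𝓝 a, r (f y) = y := by
  have : CompleteSpace V := FiniteDimensional.complete 𝕜 V
  obtain ⟨l, hl⟩ := (fderiv 𝕜 f a : V →ₗ[𝕜] W).exists_leftInverse_of_injective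
    (LinearMap.ker_eq_bot.2 hinj)
  let l' : W →L[𝕜] V := LinearMap.toContinuousLinearMap l
  have hc : ContDiffAt 𝕜 ∞ (l' ∘ f) a := l'.contDiff.contDiffAt.comp a hf
  have hd : HasFDerivAt (l' ∘ f) ((ContinuousLinearEquiv.refl 𝕜 V : V ≃L[𝕜] V) : V →L[𝕜] V) a := by
    have h := l'.hasFDerivAt.comp a (hf.differentiableAt (by simp)).hasFDerivAt
    convert h using 1
    ext x
    exact (LinearMap.congr_fun hl x).symm
  refine ⟨hc.localInverse hd (by simp) ∘ l', ?_, ?_⟩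
  · exact (hc.to_localInverse hd (by simp)).comp (f a) l'.contDiff.contDiffAt
  · exact (hc.hasStrictFDerivAt' hd (by simp)).eventually_left_inverse

/-- The part of the constant rank theorem that is needed here: if the rank of `f'` does not exceed
its value at `a` near `a`, every vector of `ker (f' a)` is tangent to a curve in the fibre of `f`
through `a`. -/
theorem exists_curve_in_fiber [FiniteDimensional 𝕜 V] [FiniteDimensional 𝕜 W]
    {f : V → W} {a : V} (hf : ContDiffAt 𝕜 ∞ f a)
    (hrank : ∀ᶠ y in 𝓝 a, Module.finrank 𝕜 (LinearMap.range (fderiv 𝕜 f y : V →ₗ[𝕜] W)) ≤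
      Module.finrank 𝕜 (LinearMap.range (fderiv 𝕜 f a : V →ₗ[𝕜] W)))
    {x : V} (hx : fderiv 𝕜 f a x = 0) :
    ∃ c : 𝕜 → V, ContDiffAt 𝕜 ∞ c 0 ∧ c 0 = a ∧ fderiv 𝕜 c 0 1 = x ∧
      ∀ᶠ t in 𝓝 0, f (c t) = f a := by
  have : CompleteSpace V := FiniteDimensional.complete 𝕜 V
  set A : V →ₗ[𝕜] W := (fderiv 𝕜 f a : V →ₗ[𝕜] W) with hA
  set R := LinearMap.range A
  set K := LinearMap.ker A
  obtain ⟨q₀, hq₀⟩ := R.subtype.exists_leftInverse_of_injective (Submodule.ker_subtype _)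
  obtain ⟨k₀, hk₀⟩ := K.subtype.exists_leftInverse_of_injective (Submodule.ker_subtype _)
  let q : W →L[𝕜] R := LinearMap.toContinuousLinearMap q₀
  let k : V →L[𝕜] K := LinearMap.toContinuousLinearMap k₀
  have hq : ∀ v : V, q (A v) = ⟨A v, LinearMap.mem_range_self A v⟩ := fun v =>
    LinearMap.congr_fun hq₀ ⟨A v, LinearMap.mem_range_self A v⟩
  have hk : ∀ (v : V) (hv : v ∈ K), k v = ⟨v, hv⟩ := fun v hv => LinearMap.congr_fun hk₀ ⟨v, hv⟩
  -- `(q ∘ f, k)` is a local diffeomorphism that straightens the fibres of `q ∘ f`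
  let h : V → R × K := fun y => (q (f y), k y)
  have hh : ContDiffAt 𝕜 ∞ h a :=
    (q.contDiff.contDiffAt.comp a hf).prodMk k.contDiff.contDiffAt
  have hder : ∀ y, DifferentiableAt 𝕜 f y →
      HasFDerivAt h ((q.comp (fderiv 𝕜 f y)).prod k) y := fun y hy =>
    (q.hasFDerivAt.comp y hy.hasFDerivAt).prodMk k.hasFDerivAt
  have hinj : Function.Injective ((q.comp (fderiv 𝕜 f a)).prod k : V →ₗ[𝕜] R × K) := by
    rw [← LinearMap.ker_eq_bot, LinearMap.ker_eq_bot']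
    intro v hv
    have h1 : q (A v) = 0 := congrArg Prod.fst hv
    have h2 : k v = 0 := congrArg Prod.snd hv
    rw [hq v] at h1
    have h3 : v ∈ K := congrArg Subtype.val h1
    rw [hk v h3] at h2
    exact congrArg Subtype.val h2
  have hdim : Module.finrank 𝕜 V = Module.finrank 𝕜 (R × K) := by
    rw [Module.finrank_prod, LinearMap.finrank_range_add_finrank_ker]
  let e : V ≃L[𝕜] R × K :=
    (LinearEquiv.ofInjectiveOfFinrankEq _ hinj hdim).toContinuousLinearEquiv
  have he : (e : V →L[𝕜] R × K) = (q.comp (fderiv 𝕜 f a)).prod k := rfl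
  have hd : HasFDerivAt h (e : V →L[𝕜] R × K) a := he ▸ hder a (hf.differentiableAt (by simp))
  have hstrict := hh.hasStrictFDerivAt' hd (by simp)
  set g := hh.localInverse hd (by simp)
  have hg : ContDiffAt 𝕜 ∞ g (h a) := hh.to_localInverse hd (by simp)
  have hga : g (h a) = a := hh.localInverse_apply_image hd (by simp)
  let l : 𝕜 → R × K := fun t => h a + t • (0, ⟨x, hx⟩)
  have hl : ContDiff 𝕜 ∞ l := contDiff_const.add (contDiff_id.smul contDiff_const)
  have hl0 : l 0 = h a := by simp [l]
  have hl' : HasFDerivAt l ((1 : 𝕜 →L[𝕜] 𝕜).smulRight ((0, ⟨x, hx⟩) : R × K)) 0 := by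
    have := ((hasFDerivAt_id (𝕜 := 𝕜) (0 : 𝕜)).smul_const ((0, ⟨x, hx⟩) : R × K)).const_add (h a)
    exact this
  have hc : ContDiffAt 𝕜 ∞ (g ∘ l) 0 := by
    refine ContDiffAt.comp 0 ?_ hl.contDiffAt
    rwa [hl0]
  have hc0 : (g ∘ l) 0 = a := by simp [hl0, hga]
  have hgd : HasFDerivAt g (e.symm : R × K →L[𝕜] V) (l 0) := by
    rw [hl0]; exact hstrict.to_localInverse.hasFDerivAt
  refine ⟨g ∘ l, hc, hc0, ?_, ?_⟩
  · rw [(hgd.comp 0 hl').fderiv]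
    have hex : e x = (0, ⟨x, hx⟩) := by
      have h1 : q (A x) = 0 := by
        rw [hq x]; exact Subtype.ext hx
      exact Prod.ext h1 (hk x hx)
    simp [← hex]
  · have hcont : ContinuousAt (g ∘ l) 0 := hc.continuousAt
    have e1 : ∀ᶠ y in 𝓝 a, ContDiffAt 𝕜 1 f y := (hf.of_le (by simp)).eventually (by simp)
    have e2 : ∀ᶠ t in 𝓝 (0 : 𝕜), ContDiffAt 𝕜 1 (g ∘ l) t :=
      (hc.of_le (by simp)).eventually (by simp)
    have e3 : ∀ᶠ t in 𝓝 (0 : 𝕜), h (g (l t)) = l t := by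
      have : ∀ᶠ w in 𝓝 (l 0), h (g w) = w := by
        rw [hl0]; exact hstrict.eventually_right_inverse
      exact hl.continuous.continuousAt.eventually this
    have e4 : ∀ᶠ y in 𝓝 a, fderiv 𝕜 h y ∈ range ((↑) : (V ≃L[𝕜] R × K) → V →L[𝕜] R × K) := by
      have : ContinuousAt (fderiv 𝕜 h) a :=
        (hh.fderiv_right (m := 0) (by simp)).continuousAt
      refine this.eventually ?_
      rw [hd.fderiv]
      exact ContinuousLinearEquiv.nhds e
    have hca : Tendsto (g ∘ l) (𝓝 0) (𝓝 a) := by simpa only [hc0] using hcont.tendsto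
    have hall := (hca.eventually (e1.and (e4.and hrank))).and (e2.and e3)
    obtain ⟨ε, hε, hball⟩ := Metric.eventually_nhds_iff_ball.1 hall
    have hdiff : ∀ t ∈ Metric.ball (0 : 𝕜) ε, HasFDerivAt (f ∘ (g ∘ l))
        ((fderiv 𝕜 f (g (l t))).comp (fderiv 𝕜 (g ∘ l) t)) t := fun t ht =>
      ((hball t ht).1.1.differentiableAt (by simp)).hasFDerivAt.comp t
        ((hball t ht).2.1.differentiableAt (by simp)).hasFDerivAt
    have hzero : ∀ t ∈ Metric.ball (0 : 𝕜) ε, fderiv 𝕜 (f ∘ (g ∘ l)) t = 0 := by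
      intro t ht
      rw [(hdiff t ht).fderiv]
      obtain ⟨⟨hf1, ⟨e', he'⟩, hr⟩, -, -⟩ := hball t ht
      simp only [Function.comp_apply] at hf1 he' hr
      set y := g (l t)
      -- `q` is injective on the range of `f' y`, as it maps it onto `R`
      have hsurj : Function.Surjective
          (q.toLinearMap.domRestrict (LinearMap.range (fderiv 𝕜 f y : V →ₗ[𝕜] W))) := by
        intro r
        obtain ⟨v, hv⟩ := e'.surjective (r, 0)
        refine ⟨⟨fderiv 𝕜 f y v, v, rfl⟩, ?_⟩
        have h1 : fderiv 𝕜 h y v = (r, 0) := by rw [← he']; exact hv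
        rw [(hder y (hf1.differentiableAt (by simp))).fderiv] at h1
        exact congrArg Prod.fst h1
      have hqinj : Function.Injective
          (q.toLinearMap.domRestrict (LinearMap.range (fderiv 𝕜 f y : V →ₗ[𝕜] W))) := by
        rw [LinearMap.injective_iff_surjective_of_finrank_eq_finrank]
        · exact hsurj
        · exact le_antisymm hr (LinearMap.finrank_le_finrank_of_surjective hsurj)
      have hqc : HasFDerivAt (q ∘ (f ∘ (g ∘ l))) (0 : 𝕜 →L[𝕜] R) t := by
        refine (hasFDerivAt_const (q (f a)) t).congr_of_eventuallyEq ?_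
        filter_upwards [Metric.isOpen_ball.mem_nhds ht] with s hs
        have := congrArg Prod.fst (hball s hs).2.2
        simpa [l, h] using this
      have huniq := hqc.unique (q.hasFDerivAt.comp t (hdiff t ht))
      ext
      have h0 := congrArg (fun L : 𝕜 →L[𝕜] R => L 1) huniq
      have : (⟨fderiv 𝕜 f y (fderiv 𝕜 (g ∘ l) t 1), _, rfl⟩ :
          LinearMap.range (fderiv 𝕜 f y : V →ₗ[𝕜] W)) = 0 := by
        apply hqinj
        rw [map_zero]
        exact h0.symm
      exact congrArg Subtype.val this
    filter_upwards [Metric.ball_mem_nhds (0 : 𝕜) hε] with t ht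
    have hconst := (convex_ball (0 : 𝕜) ε).is_const_of_fderivWithin_eq_zero (𝕜 := 𝕜)
      (f := f ∘ (g ∘ l)) (fun s hs => (hdiff s hs).differentiableAt.differentiableWithinAt)
      (fun s hs => by
        rw [fderivWithin_of_isOpen Metric.isOpen_ball hs, hzero s hs]) ht
      (Metric.mem_ball_self hε)
    simpa [hl0, hga] using hconst

end Calculus

/-! ### Derivatives of maps between manifolds -/

section Manifolds

variable {𝕜 : Type*} [RCLike 𝕜]
  {E : Type*} [NormedAddCommGroup E] [NormedSpace 𝕜 E]
  {M : Type*} [TopologicalSpace M] [ChartedSpace E M]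
  {E' : Type*} [NormedAddCommGroup E'] [NormedSpace 𝕜 E']
  {M' : Type*} [TopologicalSpace M'] [ChartedSpace E' M']
  {E'' : Type*} [NormedAddCommGroup E''] [NormedSpace 𝕜 E'']
  {M'' : Type*} [TopologicalSpace M''] [ChartedSpace E'' M'']

/-- The derivative of a map between manifolds modelled on normed spaces, as a linear map between the
model spaces: every tangent space is by definition a copy of the model space. -/
def tderiv (𝕜 : Type*) [RCLike 𝕜]
    (E : Type*) [NormedAddCommGroup E] [NormedSpace 𝕜 E]
    (E' : Type*) [NormedAddCommGroup E'] [NormedSpace 𝕜 E']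
    {M : Type*} [TopologicalSpace M] [ChartedSpace E M]
    {M' : Type*} [TopologicalSpace M'] [ChartedSpace E' M'] (f : M → M') (x : M) : E →L[𝕜] E' :=
  mfderiv 𝓘(𝕜, E) 𝓘(𝕜, E') f x

theorem tderiv_comp {f : M → M'} {g : M' → M''} {x : M} {y : M'} (hy : f x = y)
    (hg : MDifferentiableAt 𝓘(𝕜, E') 𝓘(𝕜, E'') g y)
    (hf : MDifferentiableAt 𝓘(𝕜, E) 𝓘(𝕜, E') f x) :
    tderiv 𝕜 E E'' (g ∘ f) x = (tderiv 𝕜 E' E'' g y).comp (tderiv 𝕜 E E' f x) := by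
  subst hy
  exact mfderiv_comp x hg hf

theorem tderiv_congr {f g : M → M'} {x : M} (h : f =ᶠ[𝓝 x] g) :
    tderiv 𝕜 E E' f x = tderiv 𝕜 E E' g x :=
  h.mfderiv_eq

theorem tderiv_eq_id {f : M → M} {x : M} (hf : f =ᶠ[𝓝 x] id) :
    tderiv 𝕜 E E f x = ContinuousLinearMap.id 𝕜 E :=
  (tderiv_congr hf).trans mfderiv_id

theorem tderiv_eq_zero {f : M → M'} {x : M} {c : M'} (hf : f =ᶠ[𝓝 x] fun _ => c) :
    tderiv 𝕜 E E' f x = 0 :=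
  (tderiv_congr hf).trans mfderiv_const

theorem tderiv_eq_fderiv (f : E → E') (x : E) : tderiv 𝕜 E E' f x = fderiv 𝕜 f x :=
  mfderiv_eq_fderiv

theorem _root_.HasFDerivAt.tderiv {f : E → E'} {f' : E →L[𝕜] E'} {x : E} (h : HasFDerivAt f f' x) :
    tderiv 𝕜 E E' f x = f' :=
  (tderiv_eq_fderiv f x).trans h.fderiv

theorem mdifferentiableAt_of_smooth {f : M → M'} {x : M}
    (hf : ContMDiffAt 𝓘(𝕜, E) 𝓘(𝕜, E') ∞ f x) : MDifferentiableAt 𝓘(𝕜, E) 𝓘(𝕜, E') f x :=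
  hf.mdifferentiableAt (by simp)

theorem eventually_mdifferentiableAt_of_smooth [IsManifold 𝓘(𝕜, E) ∞ M] [IsManifold 𝓘(𝕜, E') ∞ M']
    {f : M → M'} {x : M} (hf : ContMDiffAt 𝓘(𝕜, E) 𝓘(𝕜, E') ∞ f x) :
    ∀ᶠ y in 𝓝 x, MDifferentiableAt 𝓘(𝕜, E) 𝓘(𝕜, E') f y :=
  have h1 : ContMDiffAt 𝓘(𝕜, E) 𝓘(𝕜, E') 1 f x := hf.of_le ENat.LEInfty.out
  ((contMDiffAt_iff_contMDiffAt_nhds (by simp)).1 h1).mono fun _ hy =>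
    hy.mdifferentiableAt (by simp)

/-! ### Immersions and embeddings -/

theorem _root_.Manifold.IsSmoothEmbedding.contMDiffAt_of_comp [IsManifold 𝓘(𝕜, E') ∞ M']
    {j : M' → M''} (hj : Manifold.IsSmoothEmbedding 𝓘(𝕜, E') 𝓘(𝕜, E'') ∞ j) {c : M → M'} {x : M}
    (hc : ContMDiffAt 𝓘(𝕜, E) 𝓘(𝕜, E'') ∞ (j ∘ c) x) :
    ContMDiffAt 𝓘(𝕜, E) 𝓘(𝕜, E') ∞ c x :=
  (ContMDiffAt.iff_comp_isImmersionAt (hj.isImmersion.isImmersionAt (c x))).2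
    ⟨hj.isEmbedding.continuousAt_iff.2 hc.continuousAt, hc⟩

/-- A smooth map that takes its values in the image of an embedding lifts to a smooth map. -/
theorem _root_.Manifold.IsSmoothEmbedding.exists_lift [IsManifold 𝓘(𝕜, E') ∞ M']
    {j : M' → M''} (hj : Manifold.IsSmoothEmbedding 𝓘(𝕜, E') 𝓘(𝕜, E'') ∞ j) {c : M → M''} {x : M}
    (hc : ContMDiffAt 𝓘(𝕜, E) 𝓘(𝕜, E'') ∞ c x) (hr : ∀ᶠ y in 𝓝 x, c y ∈ range j) :
    ∃ b : M → M', ContMDiffAt 𝓘(𝕜, E) 𝓘(𝕜, E') ∞ b x ∧ j ∘ b =ᶠ[𝓝 x] c := by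
  have : Nonempty M' := ⟨hr.self_of_nhds.choose⟩
  have h : j ∘ (Function.invFun j ∘ c) =ᶠ[𝓝 x] c :=
    hr.mono fun y hy => Function.invFun_eq hy
  exact ⟨_, hj.contMDiffAt_of_comp (hc.congr_of_eventuallyEq h), h⟩

/-- An immersion has a smooth local left inverse. -/
theorem _root_.Manifold.IsImmersionAt.exists_local_leftInverse
    {f : M → M'} {x : M} (h : Manifold.IsImmersionAt 𝓘(𝕜, E) 𝓘(𝕜, E') ∞ f x) :
    ∃ r : M' → M, ContMDiffAt 𝓘(𝕜, E') 𝓘(𝕜, E) ∞ r (f x) ∧ r ∘ f =ᶠ[𝓝 x] id := by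
  have key : ∀ y ∈ h.domChart.source,
      (h.equiv.symm (h.codChart (f y))).1 = h.domChart y := by
    intro y hy
    have h0 : h.domChart y ∈ (h.domChart.extend 𝓘(𝕜, E)).target := by
      simpa using h.domChart.map_source hy
    have h1 := h.writtenInCharts h0
    simp only [Function.comp_apply, mfld_simps, hy] at h1
    simp [h1]
  have hx := h.mem_domChart_source
  refine ⟨fun m => h.domChart.symm (h.equiv.symm (h.codChart m)).1, ?_, ?_⟩
  · have h1 := contMDiffAt_of_mem_maximalAtlas h.codChart_mem_maximalAtlas h.mem_codChart_source
    have h2 : ContMDiffAt 𝓘(𝕜, E') 𝓘(𝕜, E) ∞ (fun w => (h.equiv.symm w).1) (h.codChart (f x)) :=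
      (contDiff_fst.comp h.equiv.symm.contDiff).contMDiff.contMDiffAt
    have h3 : ContMDiffAt 𝓘(𝕜, E) 𝓘(𝕜, E) ∞ h.domChart.symm
        ((h.equiv.symm (h.codChart (f x))).1) := by
      rw [key x hx]
      exact contMDiffAt_symm_of_mem_maximalAtlas h.domChart_mem_maximalAtlas
        (h.domChart.map_source hx)
    exact h3.comp (f x) (h2.comp (f x) h1)
  · filter_upwards [h.domChart.open_source.mem_nhds hx] with y hy
    simp only [Function.comp_apply, id_eq]
    rw [key y hy, h.domChart.left_inv hy]

theorem tderiv_injective_of_local_leftInverse {f : M → M'} {x : M} {r : M' → M}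
    (hf : MDifferentiableAt 𝓘(𝕜, E) 𝓘(𝕜, E') f x)
    (hr : MDifferentiableAt 𝓘(𝕜, E') 𝓘(𝕜, E) r (f x)) (h : r ∘ f =ᶠ[𝓝 x] id) :
    Function.Injective (tderiv 𝕜 E E' f x) := by
  refine Function.LeftInverse.injective (g := tderiv 𝕜 E' E r (f x)) fun v => ?_
  rw [← ContinuousLinearMap.comp_apply, ← tderiv_comp rfl hr hf, tderiv_eq_id h,
    ContinuousLinearMap.id_apply]

/-- A smooth map with injective derivative at a point has a smooth local left inverse. -/
theorem exists_local_leftInverse_of_tderiv_injective [FiniteDimensional 𝕜 E]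
    [FiniteDimensional 𝕜 E'] [IsManifold 𝓘(𝕜, E) ∞ M] [IsManifold 𝓘(𝕜, E') ∞ M']
    {f : M → M'} {x : M} (hf : ContMDiffAt 𝓘(𝕜, E) 𝓘(𝕜, E') ∞ f x)
    (hinj : Function.Injective (tderiv 𝕜 E E' f x)) :
    ∃ r : M' → M, ContMDiffAt 𝓘(𝕜, E') 𝓘(𝕜, E) ∞ r (f x) ∧ r ∘ f =ᶠ[𝓝 x] id := by
  have hw : ContDiffAt 𝕜 ∞ (writtenInExtChartAt 𝓘(𝕜, E) 𝓘(𝕜, E') x f)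
      (extChartAt 𝓘(𝕜, E) x x) := by
    have := (contMDiffAt_iff.1 hf).2
    simpa [ContDiffWithinAt, writtenInExtChartAt] using this.contDiffAt (by simp)
  have hd : Function.Injective (fderiv 𝕜 (writtenInExtChartAt 𝓘(𝕜, E) 𝓘(𝕜, E') x f)
      (extChartAt 𝓘(𝕜, E) x x)) := by
    have h : tderiv 𝕜 E E' f x = fderiv 𝕜 (writtenInExtChartAt 𝓘(𝕜, E) 𝓘(𝕜, E') x f)
        (extChartAt 𝓘(𝕜, E) x x) := by
      refine (mdifferentiableAt_of_smooth hf).mfderiv.trans ?_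
      rw [ModelWithCorners.range_eq_univ, fderivWithin_univ]
    rwa [h] at hinj
  obtain ⟨r, hr, hrf⟩ := exists_local_leftInverse hw hd
  have hval : writtenInExtChartAt 𝓘(𝕜, E) 𝓘(𝕜, E') x f (extChartAt 𝓘(𝕜, E) x x) =
      extChartAt 𝓘(𝕜, E') (f x) (f x) := by
    simp [writtenInExtChartAt]
  have hr0 : r (extChartAt 𝓘(𝕜, E') (f x) (f x)) = extChartAt 𝓘(𝕜, E) x x := by
    rw [← hval]; exact hrf.self_of_nhds
  rw [hval] at hr
  refine ⟨(extChartAt 𝓘(𝕜, E) x).symm ∘ r ∘ extChartAt 𝓘(𝕜, E') (f x), ?_, ?_⟩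
  · have h1 : ContMDiffAt 𝓘(𝕜, E') 𝓘(𝕜, E') ∞ (extChartAt 𝓘(𝕜, E') (f x)) (f x) :=
      contMDiffAt_extChartAt
    have h3 : ContMDiffAt 𝓘(𝕜, E) 𝓘(𝕜, E) ∞ (extChartAt 𝓘(𝕜, E) x).symm
        ((r ∘ extChartAt 𝓘(𝕜, E') (f x)) (f x)) := by
      rw [Function.comp_apply, hr0]
      exact (contMDiffOn_extChartAt_symm x).contMDiffAt (extChartAt_target_mem_nhds x)
    exact h3.comp (f x) (hr.contMDiffAt.comp (f x) h1)
  · have h1 := (continuousAt_extChartAt (I := 𝓘(𝕜, E)) x).eventually hrf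
    filter_upwards [h1, extChartAt_source_mem_nhds (I := 𝓘(𝕜, E)) x] with y hy hys
    simp only [writtenInExtChartAt, Function.comp_apply] at hy ⊢
    rw [(extChartAt 𝓘(𝕜, E) x).left_inv hys] at hy
    rw [hy, (extChartAt 𝓘(𝕜, E) x).left_inv hys, id]

/-! ### Submersions -/

section Submersion

variable {F : Type*} [NormedAddCommGroup F] [NormedSpace 𝕜 F]

theorem _root_.Manifold.IsSubmersionAtOfComplement.codChart_apply {π : M → M'} {p : M}
    (h : Manifold.IsSubmersionAtOfComplement F 𝓘(𝕜, E) 𝓘(𝕜, E') ∞ π p) {y : E}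
    (hy : y ∈ h.domChart.target) : h.codChart (π (h.domChart.symm y)) = (h.equiv y).1 := by
  have h0 : y ∈ (h.domChart.extend 𝓘(𝕜, E)).target := by simpa using hy
  have h1 := h.writtenInCharts h0
  simpa only [Function.comp_apply, mfld_simps] using h1

/-- A submersion has smooth local sections. -/
theorem _root_.Manifold.IsSubmersionAtOfComplement.exists_local_section {π : M → M'} {p : M}
    (h : Manifold.IsSubmersionAtOfComplement F 𝓘(𝕜, E) 𝓘(𝕜, E') ∞ π p) :
    ∃ σ : M' → M, ContMDiffAt 𝓘(𝕜, E') 𝓘(𝕜, E) ∞ σ (π p) ∧ σ (π p) = p ∧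
      ∀ᶠ q in 𝓝 (π p), π (σ q) = q := by
  have hp := h.mem_domChart_source
  have hπp := h.mem_codChart_source
  let l : M' → E := fun q => h.equiv.symm (h.codChart q, (h.equiv (h.domChart p)).2)
  have hl : ContMDiffAt 𝓘(𝕜, E') 𝓘(𝕜, E) ∞ l (π p) := by
    have h1 := contMDiffAt_of_mem_maximalAtlas h.codChart_mem_maximalAtlas hπp
    have h2 : ContMDiffAt 𝓘(𝕜, E') 𝓘(𝕜, E) ∞
        (fun w => h.equiv.symm (w, (h.equiv (h.domChart p)).2)) (h.codChart (π p)) :=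
      (h.equiv.symm.contDiff.comp (contDiff_id.prodMk contDiff_const)).contMDiff.contMDiffAt
    exact h2.comp (π p) h1
  have hl0 : l (π p) = h.domChart p := by
    have := h.codChart_apply (h.domChart.map_source hp)
    rw [h.domChart.left_inv hp] at this
    simp only [l, this, Prod.mk.eta, ContinuousLinearEquiv.symm_apply_apply]
  refine ⟨h.domChart.symm ∘ l, ?_, ?_, ?_⟩
  · refine ContMDiffAt.comp (π p) ?_ hl
    rw [hl0]
    exact contMDiffAt_symm_of_mem_maximalAtlas h.domChart_mem_maximalAtlas
      (h.domChart.map_source hp)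
  · simp [hl0, h.domChart.left_inv hp]
  · have h1 : ∀ᶠ q in 𝓝 (π p), l q ∈ h.domChart.target := by
      refine hl.continuousAt.eventually ?_
      rw [hl0]
      exact h.domChart.open_target.mem_nhds (h.domChart.map_source hp)
    filter_upwards [h1, h.codChart.open_source.mem_nhds hπp] with q hq hqs
    refine h.codChart.injOn (h.source_subset_preimage_source (h.domChart.map_target hq)) hqs ?_
    rw [h.codChart_apply hq]
    simp [l]

/-- The fibre of a submersion through `p` is parametrised near `p` by a neighbourhood of `0` in the
complement `F`, and its tangent spaces contain the kernel of the derivative. -/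
theorem _root_.Manifold.IsSubmersionAtOfComplement.exists_fiber_parametrization {π : M → M'} {p : M}
    (h : Manifold.IsSubmersionAtOfComplement F 𝓘(𝕜, E) 𝓘(𝕜, E') ∞ π p) :
    ∃ ψ : F → M, ∀ᶠ u in 𝓝 (0 : F), ContMDiffAt 𝓘(𝕜, F) 𝓘(𝕜, E) ∞ ψ u ∧ π (ψ u) = π p ∧
      ∀ v : E, tderiv 𝕜 E E' π (ψ u) v = 0 →
        ∃ s : F, tderiv 𝕜 F E ψ u s = v := by
  have hp := h.mem_domChart_source
  set z := h.equiv (h.domChart p) with hz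
  let l : F → E := fun u => h.equiv.symm (z.1, z.2 + u)
  have hl : ContDiff 𝕜 ∞ l :=
    h.equiv.symm.contDiff.comp (contDiff_const.prodMk (contDiff_const.add contDiff_id))
  have hl0 : l 0 = h.domChart p := by simp [l, hz]
  have h1 : ∀ᶠ u in 𝓝 (0 : F), l u ∈ h.domChart.target := by
    refine hl.continuous.continuousAt.eventually ?_
    rw [hl0]
    exact h.domChart.open_target.mem_nhds (h.domChart.map_source hp)
  have hcod : h.codChart (π p) = z.1 := by
    have := h.codChart_apply (h.domChart.map_source hp)
    rwa [h.domChart.left_inv hp] at this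
  refine ⟨h.domChart.symm ∘ l, h1.mono fun u hu => ?_⟩
  have hsymm := contMDiffAt_symm_of_mem_maximalAtlas h.domChart_mem_maximalAtlas hu
  have hψ : ContMDiffAt 𝓘(𝕜, F) 𝓘(𝕜, E) ∞ (h.domChart.symm ∘ l) u :=
    hsymm.comp u hl.contMDiff.contMDiffAt
  have hmem := h.domChart.map_target hu
  set m : M := h.domChart.symm (l u) with hm
  have hdm : h.domChart m = l u := h.domChart.right_inv hu
  refine ⟨hψ, ?_, fun v hv => ?_⟩
  · refine h.codChart.injOn (h.source_subset_preimage_source hmem) h.mem_codChart_source ?_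
    rw [hm, h.codChart_apply hu, hcod]
    simp [l]
  · have hdom := contMDiffAt_of_mem_maximalAtlas h.domChart_mem_maximalAtlas hmem
    have hD := mdifferentiableAt_of_smooth hdom
    have hS := mdifferentiableAt_of_smooth hsymm
    set a : E := tderiv 𝕜 E E h.domChart m v with ha
    have hva : tderiv 𝕜 E E h.domChart.symm (l u) a = v := by
      rw [ha, ← ContinuousLinearMap.comp_apply, ← tderiv_comp hdm hS hD,
        tderiv_eq_id (f := h.domChart.symm ∘ h.domChart) (h.domChart.eventually_left_inverse hmem),
        ContinuousLinearMap.id_apply]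
    -- in the charts the submersion is the first projection, so `a` is vertical
    have ha1 : (h.equiv a).1 = 0 := by
      have hC : MDifferentiableAt 𝓘(𝕜, E') 𝓘(𝕜, E') h.codChart (π m) :=
        mdifferentiableAt_of_smooth (contMDiffAt_of_mem_maximalAtlas h.codChart_mem_maximalAtlas
          (h.source_subset_preimage_source hmem))
      have hπ := mdifferentiableAt_of_smooth
        (h.contMDiffOn.contMDiffAt (h.domChart.open_source.mem_nhds hmem))
      have e1 : h.codChart ∘ π =ᶠ[𝓝 m] (fun y => (h.equiv y).1) ∘ h.domChart := by
        filter_upwards [h.domChart.open_source.mem_nhds hmem] with y hy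
        have := h.codChart_apply (h.domChart.map_source hy)
        rwa [h.domChart.left_inv hy] at this
      have hlin : HasFDerivAt (fun y => (h.equiv y).1)
          ((ContinuousLinearMap.fst 𝕜 E' F).comp (h.equiv : E →L[𝕜] E' × F)) (h.domChart m) :=
        ((ContinuousLinearMap.fst 𝕜 E' F).comp (h.equiv : E →L[𝕜] E' × F)).hasFDerivAt
      have e2 := tderiv_comp rfl hC hπ
      rw [tderiv_congr e1, tderiv_comp rfl hlin.differentiableAt.mdifferentiableAt hD,
        hlin.tderiv] at e2
      have e3 := DFunLike.congr_fun e2 v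
      have hv' : tderiv 𝕜 E E' π m v = 0 := hv
      rw [ContinuousLinearMap.comp_apply (tderiv 𝕜 E' E' _ _), hv', map_zero] at e3
      exact e3
    refine ⟨(h.equiv a).2, ?_⟩
    have hl' : HasFDerivAt l ((h.equiv.symm : E' × F →L[𝕜] E).comp
        (ContinuousLinearMap.inr 𝕜 E' F)) u := by
      have i1 : HasFDerivAt (fun u : F => (z.1, z.2 + u)) (ContinuousLinearMap.inr 𝕜 E' F) u :=
        (hasFDerivAt_const z.1 u).prodMk ((hasFDerivAt_id u).const_add z.2)
      exact h.equiv.symm.hasFDerivAt.comp u i1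
    rw [tderiv_comp rfl hS hl'.differentiableAt.mdifferentiableAt, hl'.tderiv,
      ContinuousLinearMap.comp_apply]
    have : (h.equiv.symm : E' × F →L[𝕜] E).comp (ContinuousLinearMap.inr 𝕜 E' F) (h.equiv a).2
        = a := by
      change h.equiv.symm (0, (h.equiv a).2) = a
      rw [← ha1, Prod.mk.eta, ContinuousLinearEquiv.symm_apply_apply]
    rw [this, hva]

end Submersion

end Manifolds

/-! ### Forms that are locally pullbacks of a symplectic form -/

section LocalPullback

variable {𝕜 : Type*} [RCLike 𝕜]
  {E : Type*} [NormedAddCommGroup E] [NormedSpace 𝕜 E]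
  {M : Type*} [TopologicalSpace M] [ChartedSpace E M]
  {E' : Type*} [NormedAddCommGroup E'] [NormedSpace 𝕜 E']
  {M' : Type*} [TopologicalSpace M'] [ChartedSpace E' M']
  {E'' : Type*} [NormedAddCommGroup E''] [NormedSpace 𝕜 E'']
  {M'' : Type*} [TopologicalSpace M''] [ChartedSpace E'' M'']

/-- The value of a 2-form at a point, as an alternating form on the model space. -/
def TwoForm.form (Ω : TwoForm 𝕜 E M) (p : M) : E [⋀^Fin 2]→L[𝕜] 𝕜 := Ω p

theorem TwoForm.form_pullback (f : M → M') (Ω : TwoForm 𝕜 E' M') (p : M) :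
    (TwoForm.pullback (E := E) f Ω).form p =
      (Ω.form (f p)).compContinuousLinearMap (tderiv 𝕜 E E' f p) := rfl

theorem TwoForm.form_pullback_apply (f : M → M') (Ω : TwoForm 𝕜 E' M') (p : M) (v w : E) :
    (TwoForm.pullback (E := E) f Ω).form p ![v, w] =
      Ω.form (f p) ![tderiv 𝕜 E E' f p v, tderiv 𝕜 E E' f p w] := by
  rw [TwoForm.form_pullback, ContinuousAlternatingMap.compContinuousLinearMap_apply]
  congr 1
  ext i
  fin_cases i <;> rfl

theorem TwoForm.form_pullback_comp {f : M → M'} {g : M' → M''} (Ω : TwoForm 𝕜 E'' M'') {p : M}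
    (hg : MDifferentiableAt 𝓘(𝕜, E') 𝓘(𝕜, E'') g (f p))
    (hf : MDifferentiableAt 𝓘(𝕜, E) 𝓘(𝕜, E') f p) :
    (TwoForm.pullback (E := E) (g ∘ f) Ω).form p =
      (TwoForm.pullback (E := E) f (TwoForm.pullback (E := E') g Ω)).form p := by
  rw [TwoForm.form_pullback, TwoForm.form_pullback, TwoForm.form_pullback, tderiv_comp rfl hg hf]
  rfl

theorem TwoForm.form_pullback_id (Ω : TwoForm 𝕜 E M) {f : M → M} {p : M} (h : f =ᶠ[𝓝 p] id) :
    (TwoForm.pullback (E := E) f Ω).form p = Ω.form p := by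
  rw [TwoForm.form_pullback, tderiv_eq_id h, h.self_of_nhds]
  rfl

/-- A 2-form is the pullback along a chart of its expression in this chart. -/
theorem TwoForm.form_eq_inChart [IsManifold 𝓘(𝕜, E) ∞ M] (Ω : TwoForm 𝕜 E M) {m₀ m : M}
    (hm : m ∈ (extChartAt 𝓘(𝕜, E) m₀).source) :
    Ω.form m = (Ω.inChart m₀ (extChartAt 𝓘(𝕜, E) m₀ m)).compContinuousLinearMap
      (tderiv 𝕜 E E (extChartAt 𝓘(𝕜, E) m₀) m) := by
  have h1 : MDifferentiableAt 𝓘(𝕜, E) 𝓘(𝕜, E) (extChartAt 𝓘(𝕜, E) m₀) m :=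
    mdifferentiableAt_of_smooth (contMDiffAt_extChartAt' (by simpa using hm))
  have h2 : MDifferentiableAt 𝓘(𝕜, E) 𝓘(𝕜, E) (extChartAt 𝓘(𝕜, E) m₀).symm
      (extChartAt 𝓘(𝕜, E) m₀ m) :=
    mdifferentiableAt_of_smooth ((contMDiffOn_extChartAt_symm m₀).contMDiffAt
      ((isOpen_extChartAt_target m₀).mem_nhds ((extChartAt 𝓘(𝕜, E) m₀).map_source hm)))
  have h3 : (extChartAt 𝓘(𝕜, E) m₀).symm ∘ extChartAt 𝓘(𝕜, E) m₀ =ᶠ[𝓝 m] id := by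
    filter_upwards [(isOpen_extChartAt_source m₀).mem_nhds hm] with y hy
    exact (extChartAt 𝓘(𝕜, E) m₀).left_inv hy
  rw [← Ω.form_pullback_id h3, TwoForm.form_pullback_comp Ω h2 h1]
  rfl

/-- A 2-form that is locally a pullback of a smooth closed form is smooth and closed. -/
theorem contDiffAt_and_extDeriv_eq_zero_of_locally_pullback
    [IsManifold 𝓘(𝕜, E) ∞ M] [IsManifold 𝓘(𝕜, E') ∞ M']
    {Ω : TwoForm 𝕜 E M} (hΩ : IsSymplectic Ω) {Ω' : TwoForm 𝕜 E' M'}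
    (h : ∀ q : M', ∃ s : M' → M, ContMDiffAt 𝓘(𝕜, E') 𝓘(𝕜, E) ∞ s q ∧
      ∀ᶠ q' in 𝓝 q, Ω'.form q' = (TwoForm.pullback (E := E') s Ω).form q')
    (x₀ : M') {y : E'} (hy : y ∈ (extChartAt 𝓘(𝕜, E') x₀).target) :
    ContDiffAt 𝕜 ∞ (Ω'.inChart x₀) y ∧ extDeriv (Ω'.inChart x₀) y = 0 := by
  set e := extChartAt 𝓘(𝕜, E') x₀ with he
  obtain ⟨s, hs, hform⟩ := h (e.symm y)
  set m := s (e.symm y) with hm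
  set ψ := extChartAt 𝓘(𝕜, E) m with hψ
  let F : E' → E := ψ ∘ s ∘ e.symm
  have hopen : IsOpen e.target := isOpen_extChartAt_target x₀
  have hesm : ∀ y' ∈ e.target, ContMDiffAt 𝓘(𝕜, E') 𝓘(𝕜, E') ∞ e.symm y' := fun y' hy' =>
    (contMDiffOn_extChartAt_symm x₀).contMDiffAt (hopen.mem_nhds hy')
  have hF : ContDiffAt 𝕜 ∞ F y := by
    have h1 : ContMDiffAt 𝓘(𝕜, E) 𝓘(𝕜, E) ∞ ψ (s (e.symm y)) := contMDiffAt_extChartAt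
    exact (h1.comp y (hs.comp y (hesm y hy))).contDiffAt
  have hec : Tendsto e.symm (𝓝 y) (𝓝 (e.symm y)) := (hesm y hy).continuousAt
  have hs1 := eventually_mdifferentiableAt_of_smooth hs
  have hsrc : ∀ᶠ q' in 𝓝 (e.symm y), s q' ∈ ψ.source :=
    hs.continuousAt.eventually (extChartAt_source_mem_nhds m)
  have hev : Ω'.inChart x₀ =ᶠ[𝓝 y] fun y' =>
      (Ω.inChart m (F y')).compContinuousLinearMap (fderiv 𝕜 F y') := by
    filter_upwards [hopen.mem_nhds hy, hec.eventually hform, hec.eventually hs1,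
      hec.eventually hsrc] with y' hy' h1 hds h3
    have hde := mdifferentiableAt_of_smooth (hesm y' hy')
    have hdψ : MDifferentiableAt 𝓘(𝕜, E) 𝓘(𝕜, E) ψ ((s ∘ e.symm) y') :=
      mdifferentiableAt_of_smooth (contMDiffAt_extChartAt' (by simpa [hψ] using h3))
    change (Ω'.form (e.symm y')).compContinuousLinearMap (tderiv 𝕜 E' E' e.symm y') = _
    rw [← tderiv_eq_fderiv, tderiv_comp rfl hdψ (hds.comp y' hde), tderiv_comp rfl hds hde, h1,
      TwoForm.form_pullback, TwoForm.form_eq_inChart Ω h3]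
    rfl
  have hFy : F y ∈ ψ.target := ψ.map_source (mem_extChartAt_source m)
  have hsm : ContDiffAt 𝕜 ∞ (Ω.inChart m) (F y) :=
    (hΩ.smooth m).contDiffAt ((isOpen_extChartAt_target m).mem_nhds hFy)
  constructor
  · exact (contDiffAt_compContinuousLinearMap (hsm.comp y hF)
      (hF.fderiv_right (by simp))).congr_of_eventuallyEq hev
  · rw [hev.extDeriv_eq, extDeriv_pullback (hsm.differentiableAt (by simp)) hF
      (by rw [minSmoothness_of_isRCLikeNormedField]; exact ENat.LEInfty.out), hΩ.closed m _ hFy]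
    ext v
    rfl

end LocalPullback

/-! ### Regular level sets -/

section RegularLevel

variable {𝕜 : Type*} [RCLike 𝕜]
  {E : Type*} [NormedAddCommGroup E] [NormedSpace 𝕜 E]
  {M : Type*} [TopologicalSpace M]
  {W : Type*} [NormedAddCommGroup W] [NormedSpace 𝕜 W]
  {X : Type*} [NormedAddCommGroup X] [NormedSpace 𝕜 X]

/-- The chart of the level set `μ⁻¹(ξ)` obtained by restricting a slice chart of `M`. -/
def levelChart {μ : M → W} {ξ : W} (B : (X × W) ≃L[𝕜] E) (S : OpenPartialHomeomorph M E)
    (hS : ∀ m ∈ S.source, (B.symm (S m)).2 = μ m - ξ) (p₀ : μ ⁻¹' {ξ}) :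
    OpenPartialHomeomorph (μ ⁻¹' {ξ}) X where
  toFun p := (B.symm (S p)).1
  invFun u := by
    classical
    exact if h : μ (S.symm (B (u, 0))) = ξ then ⟨S.symm (B (u, 0)), h⟩ else p₀
  source := Subtype.val ⁻¹' S.source
  target := (fun u => B (u, 0)) ⁻¹' S.target
  map_source' p hp := by
    have h1 : (B.symm (S p)).2 = 0 := by rw [hS p hp, p.2, sub_self]
    have h2 : B ((B.symm (S p)).1, 0) = S p := by
      rw [← h1, Prod.mk.eta, ContinuousLinearEquiv.apply_symm_apply]
    simp only [mem_preimage, h2]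
    exact S.map_source hp
  map_target' u hu := by
    have h1 : μ (S.symm (B (u, 0))) = ξ := by
      have := hS _ (S.map_target hu)
      rw [S.right_inv hu, ContinuousLinearEquiv.symm_apply_apply] at this
      exact (sub_eq_zero.1 this.symm)
    rw [dif_pos h1]
    exact S.map_target hu
  left_inv' p hp := by
    have h1 : (B.symm (S p)).2 = 0 := by rw [hS p hp, p.2, sub_self]
    have h2 : B ((B.symm (S p)).1, 0) = S p := by
      rw [← h1, Prod.mk.eta, ContinuousLinearEquiv.apply_symm_apply]
    have h3 : S.symm (B ((B.symm (S p)).1, 0)) = p := by rw [h2, S.left_inv hp]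
    rw [dif_pos (by rw [h3]; exact p.2)]
    exact Subtype.ext h3
  right_inv' u hu := by
    have h1 : μ (S.symm (B (u, 0))) = ξ := by
      have := hS _ (S.map_target hu)
      rw [S.right_inv hu, ContinuousLinearEquiv.symm_apply_apply] at this
      exact (sub_eq_zero.1 this.symm)
    rw [dif_pos h1, S.right_inv hu, ContinuousLinearEquiv.symm_apply_apply]
  open_source := S.open_source.preimage continuous_subtype_val
  open_target := S.open_target.preimage (B.continuous.comp (Continuous.prodMk_left 0))
  continuousOn_toFun := by
    have h1 : ContinuousOn (fun p : μ ⁻¹' {ξ} => S p) (Subtype.val ⁻¹' S.source) :=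
      S.continuousOn.comp continuous_subtype_val.continuousOn (mapsTo_preimage _ _)
    exact (continuous_fst.comp B.symm.continuous).comp_continuousOn h1
  continuousOn_invFun := by
    rw [Topology.IsInducing.subtypeVal.continuousOn_iff]
    have h1 : ContinuousOn (fun u => S.symm (B (u, 0))) ((fun u => B (u, 0)) ⁻¹' S.target) :=
      S.continuousOn_symm.comp (B.continuous.comp (Continuous.prodMk_left 0)).continuousOn
        (mapsTo_preimage _ _)
    refine h1.congr fun u hu => ?_
    have h1 : μ (S.symm (B (u, 0))) = ξ := by
      have := hS _ (S.map_target hu)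
      rw [S.right_inv hu, ContinuousLinearEquiv.symm_apply_apply] at this
      exact (sub_eq_zero.1 this.symm)
    simp only [Function.comp_apply]
    rw [dif_pos h1]

theorem levelChart_symm_coe {μ : M → W} {ξ : W} (B : (X × W) ≃L[𝕜] E)
    (S : OpenPartialHomeomorph M E) (hS : ∀ m ∈ S.source, (B.symm (S m)).2 = μ m - ξ)
    (p₀ : μ ⁻¹' {ξ}) {u : X} (hu : u ∈ (levelChart B S hS p₀).target) :
    ((levelChart B S hS p₀).symm u : M) = S.symm (B (u, 0)) := by
  have hmem := (levelChart B S hS p₀).map_target hu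
  have h1 : (B.symm (S ((levelChart B S hS p₀).symm u))).1 = u :=
    (levelChart B S hS p₀).right_inv hu
  have h2 : (B.symm (S ((levelChart B S hS p₀).symm u))).2 = 0 := by
    rw [hS _ hmem, ((levelChart B S hS p₀).symm u).2, sub_self]
  have h3 : B.symm (S ((levelChart B S hS p₀).symm u)) = (u, 0) := Prod.ext h1 h2
  rw [← h3, ContinuousLinearEquiv.apply_symm_apply, S.left_inv hmem]

variable [ChartedSpace E M]

theorem trans_mem_maximalAtlas {G : StructureGroupoid E} {e : OpenPartialHomeomorph M E}
    (he : e ∈ G.maximalAtlas M) [HasGroupoid M G] {T : OpenPartialHomeomorph E E} (hT : T ∈ G) :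
    e ≫ₕ T ∈ G.maximalAtlas M := by
  rw [mem_maximalAtlas_iff] at he ⊢
  intro e' he'
  obtain ⟨h1, h2⟩ := he e' he'
  constructor
  · rw [OpenPartialHomeomorph.trans_symm_eq_symm_trans_symm, OpenPartialHomeomorph.trans_assoc]
    exact G.trans (G.symm hT) h1
  · rw [← OpenPartialHomeomorph.trans_assoc]
    exact G.trans h2 hT

theorem mem_contDiffGroupoid_of_contDiffOn {T : OpenPartialHomeomorph E E}
    (h1 : ContDiffOn 𝕜 ∞ T T.source) (h2 : ContDiffOn 𝕜 ∞ T.symm T.target) :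
    T ∈ contDiffGroupoid ∞ 𝓘(𝕜, E) := by
  rw [contDiffGroupoid, mem_groupoid_of_pregroupoid]
  simpa [contDiffPregroupoid] using ⟨h1, h2⟩

theorem contDiffOn_of_mem_contDiffGroupoid {T : OpenPartialHomeomorph E E}
    (h : T ∈ contDiffGroupoid ∞ 𝓘(𝕜, E)) : ContDiffOn 𝕜 ∞ T T.source := by
  rw [contDiffGroupoid, mem_groupoid_of_pregroupoid] at h
  simpa [contDiffPregroupoid] using h.1

/-- Around a point where the derivative of `μ` is surjective there is a chart of `M`, with values in
`E ≃ X × W`, whose second component is `μ - ξ`. -/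
theorem exists_slice_chart [FiniteDimensional 𝕜 E] [FiniteDimensional 𝕜 W] [FiniteDimensional 𝕜 X]
    [IsManifold 𝓘(𝕜, E) ∞ M] {μ : M → W} (hμ : ContMDiff 𝓘(𝕜, E) 𝓘(𝕜, W) ∞ μ) (ξ : W)
    (B : (X × W) ≃L[𝕜] E) {p : M} (hp : Function.Surjective (tderiv 𝕜 E W μ p)) :
    ∃ S ∈ IsManifold.maximalAtlas 𝓘(𝕜, E) ∞ M, p ∈ S.source ∧
      ∀ m ∈ S.source, (B.symm (S m)).2 = μ m - ξ := by
  have : CompleteSpace E := FiniteDimensional.complete 𝕜 E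
  set e := chartAt E p
  have hpe : p ∈ e.source := mem_chart_source E p
  have he : e ∈ IsManifold.maximalAtlas 𝓘(𝕜, E) ∞ M := IsManifold.chart_mem_maximalAtlas p
  let f : E → W := μ ∘ e.symm
  have hf : ContDiffOn 𝕜 ∞ f e.target := fun y hy =>
    (hμ.contMDiffAt.comp y
      (contMDiffAt_symm_of_mem_maximalAtlas he hy)).contDiffAt.contDiffWithinAt
  have hfa : HasFDerivAt f (fderiv 𝕜 f (e p)) (e p) :=
    ((hf.contDiffAt (e.open_target.mem_nhds (e.map_source hpe))).differentiableAt
      (by simp)).hasFDerivAt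
  have hsurj : Function.Surjective (fderiv 𝕜 f (e p)) := by
    have h1 : μ =ᶠ[𝓝 p] f ∘ e := by
      filter_upwards [e.open_source.mem_nhds hpe] with m hm
      simp [f, e.left_inv hm]
    have h2 : tderiv 𝕜 E W μ p = (fderiv 𝕜 f (e p)).comp (tderiv 𝕜 E E e p) := by
      rw [tderiv_congr h1, tderiv_comp rfl hfa.differentiableAt.mdifferentiableAt
        (mdifferentiableAt_of_smooth (contMDiffAt_of_mem_maximalAtlas he hpe)), hfa.tderiv]
    rw [h2, ContinuousLinearMap.coe_comp] at hp
    exact hp.of_comp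
  have hdim : Module.finrank 𝕜 E = Module.finrank 𝕜 X + Module.finrank 𝕜 W := by
    rw [← B.toLinearEquiv.finrank_eq, Module.finrank_prod]
  obtain ⟨L, hL⟩ := exists_equiv_prod_of_surjective (X := X) _ hsurj hdim
  let h : E → E := fun y => B ((L y).1, f y - ξ)
  have hh : ContDiffOn 𝕜 ∞ h e.target :=
    B.contDiff.comp_contDiffOn
      ((contDiff_fst.comp L.contDiff).contDiffOn.prodMk (hf.sub contDiffOn_const))
  have hd : HasFDerivAt h ((L.trans B : E ≃L[𝕜] E) : E →L[𝕜] E) (e p) := by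
    have h1 : HasFDerivAt (fun y => (L y).1)
        ((ContinuousLinearMap.fst 𝕜 X W).comp (L : E →L[𝕜] X × W)) (e p) :=
      ((ContinuousLinearMap.fst 𝕜 X W).comp (L : E →L[𝕜] X × W)).hasFDerivAt
    have h2 := B.hasFDerivAt.comp (e p) (h1.prodMk (hfa.sub_const ξ))
    have h3 : ((L.trans B : E ≃L[𝕜] E) : E →L[𝕜] E) = (B : X × W →L[𝕜] E).comp
        (((ContinuousLinearMap.fst 𝕜 X W).comp (L : E →L[𝕜] X × W)).prod (fderiv 𝕜 f (e p))) :=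
      ContinuousLinearMap.ext fun v => congrArg B (Prod.ext rfl (hL v))
    rw [h3]
    exact h2
  obtain ⟨T, hT1, hT2, hT3, hT4⟩ :=
    exists_openPartialHomeomorph_contDiffOn e.open_target (e.map_source hpe) hh _ hd
  have hT : T ∈ contDiffGroupoid ∞ 𝓘(𝕜, E) :=
    mem_contDiffGroupoid_of_contDiffOn ((hh.mono hT2).congr fun y _ => hT3 y) hT4
  refine ⟨e ≫ₕ T, trans_mem_maximalAtlas he hT, by simp [hpe, hT1], fun m hm => ?_⟩
  have hm' : m ∈ e.source := by simp at hm; exact hm.1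
  simp [hT3, h, f, e.left_inv hm']

/-- The regular value theorem: the level set of a regular value is an embedded submanifold. -/
theorem exists_manifold_structure_level [FiniteDimensional 𝕜 E] [FiniteDimensional 𝕜 W]
    [FiniteDimensional 𝕜 X] [IsManifold 𝓘(𝕜, E) ∞ M] {μ : M → W}
    (hμ : ContMDiff 𝓘(𝕜, E) 𝓘(𝕜, W) ∞ μ) (ξ : W) (B : (X × W) ≃L[𝕜] E)
    (hreg : ∀ p, μ p = ξ → Function.Surjective (tderiv 𝕜 E W μ p)) :
    ∃ _ : ChartedSpace X (μ ⁻¹' {ξ}), IsManifold 𝓘(𝕜, X) ∞ (μ ⁻¹' {ξ}) ∧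
      Manifold.IsSmoothEmbedding 𝓘(𝕜, X) 𝓘(𝕜, E) ∞ (Subtype.val : μ ⁻¹' {ξ} → M) := by
  choose S hSmax hSp hS using fun p : μ ⁻¹' {ξ} => exists_slice_chart hμ ξ B (hreg p p.2)
  let c (p : μ ⁻¹' {ξ}) : OpenPartialHomeomorph (μ ⁻¹' {ξ}) X := levelChart B (S p) (hS p) p
  let cs : ChartedSpace X (μ ⁻¹' {ξ}) :=
    { atlas := range c
      chartAt := c
      mem_chart_source := hSp
      chart_mem_atlas := mem_range_self }
  have hman : IsManifold 𝓘(𝕜, X) ∞ (μ ⁻¹' {ξ}) := by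
    refine isManifold_of_contDiffOn _ _ _ ?_
    rintro _ _ ⟨p, rfl⟩ ⟨q, rfl⟩
    have hpq : ContDiffOn 𝕜 ∞ ((S p).symm ≫ₕ S q) ((S p).symm ≫ₕ S q).source :=
      contDiffOn_of_mem_contDiffGroupoid
        (StructureGroupoid.compatible_of_mem_maximalAtlas (hSmax p) (hSmax q))
    simp only [mfld_simps]
    have hval : ∀ u ∈ (c p).target, ((c p).symm u : M) = (S p).symm (B (u, 0)) := fun u hu =>
      levelChart_symm_coe B (S p) (hS p) p hu
    have h1 : ContDiffOn 𝕜 ∞ (fun u : X => (B.symm (((S p).symm ≫ₕ S q) (B (u, 0)))).1)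
        ((c p).target ∩ (c p).symm ⁻¹' (c q).source) := by
      refine (contDiff_fst.comp B.symm.contDiff).comp_contDiffOn
        (hpq.comp (B.contDiff.comp (contDiff_id.prodMk contDiff_const)).contDiffOn ?_)
      rintro u ⟨hu, hu'⟩
      rw [OpenPartialHomeomorph.trans_source]
      refine ⟨hu, ?_⟩
      have hu'' : ((c p).symm u : M) ∈ (S q).source := hu'
      rw [hval u hu] at hu''
      exact hu''
    refine h1.congr fun u hu => ?_
    change (B.symm (S q ((c p).symm u))).1 = _
    rw [hval u hu.1]
    rfl
  refine ⟨cs, hman, ⟨?_, Topology.IsEmbedding.subtypeVal⟩⟩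
  refine Manifold.IsImmersionOfComplement.isImmersion (F := W) fun p => ?_
  refine Manifold.IsImmersionAtOfComplement.mk_of_charts B (c p) (S p) (hSp p) (hSp p)
    (IsManifold.chart_mem_maximalAtlas p) (hSmax p) (fun _ h => h) fun u hu => ?_
  have hu' : u ∈ (c p).target := by simpa using hu
  have h1 : ((c p).symm u : M) = (S p).symm (B (u, 0)) :=
    levelChart_symm_coe B (S p) (hS p) p hu'
  simp only [Function.comp_apply, mfld_simps]
  rw [h1, (S p).right_inv hu']

/-- The tangent space of an embedded level set of a regular value is the kernel of the derivative:
every vector in the kernel is tangent to the level set. -/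
theorem exists_tderiv_eq_of_tderiv_eq_zero [FiniteDimensional 𝕜 E] [FiniteDimensional 𝕜 W]
    [IsManifold 𝓘(𝕜, E) ∞ M] {μ : M → W}
    (hμ : ContMDiff 𝓘(𝕜, E) 𝓘(𝕜, W) ∞ μ) (ξ : W) [ChartedSpace X (μ ⁻¹' {ξ})]
    [IsManifold 𝓘(𝕜, X) ∞ (μ ⁻¹' {ξ})]
    (hj : Manifold.IsSmoothEmbedding 𝓘(𝕜, X) 𝓘(𝕜, E) ∞ (Subtype.val : μ ⁻¹' {ξ} → M))
    (p : μ ⁻¹' {ξ}) (hp : Function.Surjective (tderiv 𝕜 E W μ p))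
    {v : E} (hv : tderiv 𝕜 E W μ p v = 0) :
    ∃ u : X, tderiv 𝕜 X E (Subtype.val : μ ⁻¹' {ξ} → M) p u = v := by
  let K := LinearMap.ker (tderiv 𝕜 E W μ p : E →ₗ[𝕜] W)
  have hdim : Module.finrank 𝕜 E = Module.finrank 𝕜 K + Module.finrank 𝕜 W := by
    have h := LinearMap.finrank_range_add_finrank_ker (tderiv 𝕜 E W μ p : E →ₗ[𝕜] W)
    rw [LinearMap.range_eq_top.2 hp, finrank_top] at h
    rw [← h, add_comm]
  obtain ⟨L, -⟩ := exists_equiv_prod_of_surjective (X := K) _ hp hdim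
  let B := L.symm
  obtain ⟨S, hSmax, hSp, hS⟩ := exists_slice_chart hμ ξ B hp
  -- a local retraction onto the level set, whose derivative fixes the kernel
  let pr : E →L[𝕜] E := (B : K × W →L[𝕜] E).comp
    (((ContinuousLinearMap.inl 𝕜 K W).comp (ContinuousLinearMap.fst 𝕜 K W)).comp
      (B.symm : E →L[𝕜] K × W))
  have hpr : ∀ y, pr y = B ((B.symm y).1, 0) := fun y => rfl
  have hpr_id : ∀ y, (B.symm y).2 = 0 → pr y = y := fun y hy => by
    rw [hpr, ← hy, Prod.mk.eta, ContinuousLinearEquiv.apply_symm_apply]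
  have hSp0 : (B.symm (S p)).2 = 0 := by rw [hS p hSp, p.2, sub_self]
  have hprp : pr (S p) = S p := hpr_id _ hSp0
  have hpS : (S p) ∈ S.target := S.map_source hSp
  have hS1 := contMDiffAt_of_mem_maximalAtlas hSmax hSp
  have hS2 : ContMDiffAt 𝓘(𝕜, E) 𝓘(𝕜, E) ∞ S.symm ((pr ∘ S) p) := by
    rw [Function.comp_apply, hprp]
    exact contMDiffAt_symm_of_mem_maximalAtlas hSmax hpS
  have hprS : ContMDiffAt 𝓘(𝕜, E) 𝓘(𝕜, E) ∞ (pr ∘ S) (p : M) :=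
    (pr.contDiff.contMDiff.contMDiffAt (x := S p)).comp (p : M) hS1
  let r : M → M := S.symm ∘ (pr ∘ S)
  have hr : ContMDiffAt 𝓘(𝕜, E) 𝓘(𝕜, E) ∞ r (p : M) := hS2.comp (p : M) hprS
  have hrp : r p = p := by simp [r, hprp, S.left_inv hSp]
  have hrange : ∀ᶠ m in 𝓝 (p : M), r m ∈ range (Subtype.val : μ ⁻¹' {ξ} → M) := by
    have h1 : ∀ᶠ m in 𝓝 (p : M), (pr ∘ S) m ∈ S.target := by
      refine hprS.continuousAt.eventually (S.open_target.mem_nhds ?_)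
      rwa [Function.comp_apply, hprp]
    filter_upwards [h1] with m hm
    rw [Subtype.range_coe]
    have := hS _ (S.map_target hm)
    rw [S.right_inv hm, Function.comp_apply, hpr, ContinuousLinearEquiv.symm_apply_apply] at this
    exact sub_eq_zero.1 this.symm
  obtain ⟨b, hb, hbr⟩ := hj.exists_lift hr hrange
  have hbp : b p = p := Subtype.ext (hbr.self_of_nhds.trans hrp)
  refine ⟨tderiv 𝕜 E X b (p : M) v, ?_⟩
  have hjd := mdifferentiableAt_of_smooth (hj.contMDiff p)
  rw [← ContinuousLinearMap.comp_apply, ← tderiv_comp hbp hjd (mdifferentiableAt_of_smooth hb),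
    tderiv_congr hbr]
  have hSd := mdifferentiableAt_of_smooth hS1
  have hSsd : MDifferentiableAt 𝓘(𝕜, E) 𝓘(𝕜, E) S.symm (S p) :=
    mdifferentiableAt_of_smooth (contMDiffAt_symm_of_mem_maximalAtlas hSmax hpS)
  have hv2 : (B.symm (tderiv 𝕜 E E S p v)).2 = 0 := by
    let q : E →L[𝕜] W := (ContinuousLinearMap.snd 𝕜 K W).comp (B.symm : E →L[𝕜] K × W)
    have h1 : q ∘ S =ᶠ[𝓝 (p : M)] (fun w => w - ξ) ∘ μ := by
      filter_upwards [S.open_source.mem_nhds hSp] with m hm using hS m hm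
    have h2 : HasFDerivAt (fun w : W => w - ξ) (ContinuousLinearMap.id 𝕜 W) (μ p) :=
      (hasFDerivAt_id _).sub_const ξ
    have h3 := tderiv_congr (𝕜 := 𝕜) (E := E) (E' := W) h1
    rw [tderiv_comp rfl q.hasFDerivAt.differentiableAt.mdifferentiableAt hSd,
      tderiv_comp rfl h2.differentiableAt.mdifferentiableAt
        (mdifferentiableAt_of_smooth hμ.contMDiffAt),
      q.hasFDerivAt.tderiv, h2.tderiv] at h3
    have h4 := DFunLike.congr_fun h3 v
    rw [ContinuousLinearMap.id_comp, hv] at h4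
    exact h4
  change tderiv 𝕜 E E (S.symm ∘ (pr ∘ S)) (p : M) v = v
  rw [tderiv_comp (f := pr ∘ S) hprp hSsd (mdifferentiableAt_of_smooth hprS),
    tderiv_comp rfl pr.hasFDerivAt.differentiableAt.mdifferentiableAt hSd, pr.hasFDerivAt.tderiv,
    ContinuousLinearMap.comp_apply, ContinuousLinearMap.comp_apply, hpr_id _ hv2,
    ← ContinuousLinearMap.comp_apply, ← tderiv_comp rfl hSsd hSd,
    tderiv_eq_id (f := S.symm ∘ S) (S.eventually_left_inverse hSp), ContinuousLinearMap.id_apply]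

end RegularLevel

/-! ### Moment maps and the infinitesimal action -/

section LinearAlgebra

variable {𝕜 : Type*} [RCLike 𝕜]
  {V : Type*} [NormedAddCommGroup V] [NormedSpace 𝕜 V]

/-- The linear functional `β(v, ·)`. -/
def contractLeft (β : V [⋀^Fin 2]→L[𝕜] 𝕜) (v : V) : V →ₗ[𝕜] 𝕜 :=
  (β.toMultilinearMap).toLinearMap ![v, 0] 1

theorem contractLeft_apply (β : V [⋀^Fin 2]→L[𝕜] 𝕜) (v w : V) : contractLeft β v w = β ![v, w] := by
  have h : Function.update ![v, 0] 1 w = ![v, w] := by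
    ext i
    fin_cases i <;> rfl
  change β (Function.update ![v, 0] 1 w) = _
  rw [h]

theorem form_swap (β : V [⋀^Fin 2]→L[𝕜] 𝕜) (v w : V) : β ![v, w] = -β ![w, v] := by
  have h : ![w, v] ∘ Equiv.swap (0 : Fin 2) 1 = ![v, w] := by
    ext i
    fin_cases i <;> rfl
  rw [← h]
  exact β.map_swap ![w, v] (by decide)

theorem form_sub_right (β : V [⋀^Fin 2]→L[𝕜] 𝕜) (v w w' : V) :
    β ![v, w - w'] = β ![v, w] - β ![v, w'] := by
  simp only [← contractLeft_apply, map_sub]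

theorem form_sub_left (β : V [⋀^Fin 2]→L[𝕜] 𝕜) (v v' w : V) :
    β ![v - v', w] = β ![v, w] - β ![v', w] := by
  rw [form_swap, form_sub_right, form_swap β w v, form_swap β w v']
  ring

theorem form_ext {β β' : V [⋀^Fin 2]→L[𝕜] 𝕜} (h : ∀ v w, β ![v, w] = β' ![v, w]) : β = β' := by
  ext v
  have hv : v = ![v 0, v 1] := by
    ext i
    fin_cases i <;> rfl
  rw [hv]
  exact h _ _

/-- A finite-dimensional space is reflexive. -/
theorem exists_eval_eq [FiniteDimensional 𝕜 V] (f : (V →L[𝕜] 𝕜) →ₗ[𝕜] 𝕜) :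
    ∃ x : V, ∀ η : V →L[𝕜] 𝕜, f η = η x := by
  let g : Module.Dual 𝕜 (Module.Dual 𝕜 V) :=
    f ∘ₗ (LinearMap.toContinuousLinearMap : (V →ₗ[𝕜] 𝕜) ≃ₗ[𝕜] V →L[𝕜] 𝕜).toLinearMap
  refine ⟨(Module.evalEquiv 𝕜 V).symm g, fun η => ?_⟩
  have h1 : g (η : V →ₗ[𝕜] 𝕜) = f η := by
    change f (LinearMap.toContinuousLinearMap (η : V →ₗ[𝕜] 𝕜)) = f η
    congr 1
  rw [← h1]
  exact (Module.apply_evalEquiv_symm_apply 𝕜 V (η : V →ₗ[𝕜] 𝕜) g).symm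

end LinearAlgebra

section Moment

variable {𝕜 : Type*} [RCLike 𝕜]
  {EG : Type*} [NormedAddCommGroup EG] [NormedSpace 𝕜 EG]
  {G : Type*} [TopologicalSpace G] [ChartedSpace EG G] [Group G]
  {E : Type*} [NormedAddCommGroup E] [NormedSpace 𝕜 E]
  {M : Type*} [TopologicalSpace M] [ChartedSpace E M] [MulAction G M]

/-- The derivative at `1` of the orbit map `g ↦ g • p`; its value at `x` is `-(x_M)_p`. -/
def infinitesimalAction (𝕜 : Type*) [RCLike 𝕜]
    (EG : Type*) [NormedAddCommGroup EG] [NormedSpace 𝕜 EG]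
    (G : Type*) [TopologicalSpace G] [ChartedSpace EG G] [Group G]
    (E : Type*) [NormedAddCommGroup E] [NormedSpace 𝕜 E]
    {M : Type*} [TopologicalSpace M] [ChartedSpace E M] [MulAction G M] (p : M) : EG →L[𝕜] E :=
  tderiv 𝕜 EG E (fun g : G => g • p) 1

variable (𝕜 EG G E) in
theorem contMDiff_smul_right [ContMDiffSMul 𝓘(𝕜, EG) 𝓘(𝕜, E) ∞ G M] (p : M) :
    ContMDiff 𝓘(𝕜, EG) 𝓘(𝕜, E) ∞ (fun g : G => g • p) :=
  (contMDiff_smul (I := 𝓘(𝕜, EG)) (I' := 𝓘(𝕜, E)) (n := ∞) (G := G) (M := M)).comp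
    (contMDiff_id.prodMk contMDiff_const)

variable (𝕜 EG E) in
theorem contMDiff_smul_left [ContMDiffSMul 𝓘(𝕜, EG) 𝓘(𝕜, E) ∞ G M] (g : G) :
    ContMDiff 𝓘(𝕜, E) 𝓘(𝕜, E) ∞ (fun p : M => g • p) :=
  (contMDiff_smul (I := 𝓘(𝕜, EG)) (I' := 𝓘(𝕜, E)) (n := ∞) (G := G) (M := M)).comp
    (contMDiff_const.prodMk contMDiff_id)

theorem IsSymplectic.eq_zero_of_form {Ω : TwoForm 𝕜 E M} (hΩ : IsSymplectic Ω) {p : M} {v : E}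
    (h : ∀ w : E, Ω.form p ![v, w] = 0) : v = 0 :=
  hΩ.nondegenerate p v h

variable {Ω : TwoForm 𝕜 E M} {μ : M → EG →L[𝕜] 𝕜} {ξ : EG →L[𝕜] 𝕜}

/-- The moment map condition `Ω(x_M, ·) = -dμ^x`, with both signs cancelled. -/
theorem IsHamiltonianSpace.form_infinitesimalAction (hM : IsHamiltonianSpace G Ω μ) (p : M) (x : EG)
    (v : E) :
    Ω.form p ![infinitesimalAction 𝕜 EG G E p x, v] = tderiv 𝕜 E (EG →L[𝕜] 𝕜) μ p v x := by
  have h1 : -tderiv 𝕜 E 𝕜 (fun p => μ p x) p v =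
      Ω.form p ![-infinitesimalAction 𝕜 EG G E p x, v] := (hM.moment x p v).symm
  let ev : (EG →L[𝕜] 𝕜) →L[𝕜] 𝕜 := ContinuousLinearMap.apply 𝕜 𝕜 x
  have h2 : tderiv 𝕜 E 𝕜 (ev ∘ μ) p = ev.comp (tderiv 𝕜 E (EG →L[𝕜] 𝕜) μ p) := by
    rw [tderiv_comp rfl ev.hasFDerivAt.differentiableAt.mdifferentiableAt
      (mdifferentiableAt_of_smooth hM.smooth_moment.contMDiffAt), ev.hasFDerivAt.tderiv]
  have h3 : tderiv 𝕜 E 𝕜 (fun p => μ p x) p v = tderiv 𝕜 E (EG →L[𝕜] 𝕜) μ p v x :=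
    DFunLike.congr_fun h2 v
  rw [h3, ← zero_sub (infinitesimalAction 𝕜 EG G E p x), form_sub_left, form_swap _ 0 v,
    ← contractLeft_apply _ v 0, map_zero, neg_zero, zero_sub] at h1
  exact (neg_injective h1).symm

theorem IsHamiltonianSpace.moment_smul (hM : IsHamiltonianSpace G Ω μ) {p : M} (hp : μ p = ξ)
    (g : G) : μ (g • p) = coAd g ξ := by
  rw [hM.equivariant, hp]

/-- The derivative of `g ↦ Ad^*_g ξ` at `1`, computed through a point of `μ⁻¹(ξ)`. -/
theorem IsHamiltonianSpace.tderiv_coAd [ContMDiffSMul 𝓘(𝕜, EG) 𝓘(𝕜, E) ∞ G M]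
    (hM : IsHamiltonianSpace G Ω μ) {p : M} (hp : μ p = ξ) :
    tderiv 𝕜 EG (EG →L[𝕜] 𝕜) (fun g : G => coAd g ξ) 1 =
      (tderiv 𝕜 E (EG →L[𝕜] 𝕜) μ p).comp (infinitesimalAction 𝕜 EG G E p) := by
  have h : (fun g : G => coAd g ξ) = μ ∘ fun g : G => g • p :=
    funext fun g => (hM.moment_smul hp g).symm
  rw [h, tderiv_comp (f := fun g : G => g • p) (one_smul G p)
    (mdifferentiableAt_of_smooth hM.smooth_moment.contMDiffAt)
    (mdifferentiableAt_of_smooth (contMDiff_smul_right 𝕜 EG G E p).contMDiffAt)]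
  rfl

theorem IsHamiltonianSpace.mem_coadjointStabilizerAlgebra_iff
    [ContMDiffSMul 𝓘(𝕜, EG) 𝓘(𝕜, E) ∞ G M]
    (hM : IsHamiltonianSpace G Ω μ) {p : M} (hp : μ p = ξ) (x : EG) :
    x ∈ coadjointStabilizerAlgebra G ξ ↔
      tderiv 𝕜 E (EG →L[𝕜] 𝕜) μ p (infinitesimalAction 𝕜 EG G E p x) = 0 := by
  change tderiv 𝕜 EG (EG →L[𝕜] 𝕜) (fun g : G => coAd g ξ) 1 x = 0 ↔ _
  rw [hM.tderiv_coAd hp]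
  rfl

/-- By equivariance the stabilizer in `𝔤` of a point of `μ⁻¹(ξ)` lies in `𝔤_ξ`; so if `G_ξ` acts
locally freely on `μ⁻¹(ξ)`, the infinitesimal action of all of `𝔤` is injective there. -/
theorem IsHamiltonianSpace.injective_infinitesimalAction [ContMDiffSMul 𝓘(𝕜, EG) 𝓘(𝕜, E) ∞ G M]
    (hM : IsHamiltonianSpace G Ω μ) (hfree : IsLocallyFreeOnLevel (E := E) G μ ξ)
    {p : M} (hp : μ p = ξ) : Function.Injective (infinitesimalAction 𝕜 EG G E p) := by
  rw [injective_iff_map_eq_zero]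
  intro x hx
  refine hfree p hp x ((hM.mem_coadjointStabilizerAlgebra_iff hp x).2 (by rw [hx, map_zero])) ?_
  change -infinitesimalAction 𝕜 EG G E p x = 0
  rw [hx, neg_zero]

/-- `ξ` is a regular value of `μ`: the annihilator of the range of `dμ_p` is the stabilizer of `p`
in `𝔤`. -/
theorem IsHamiltonianSpace.surjective_tderiv_moment [FiniteDimensional 𝕜 EG]
    [ContMDiffSMul 𝓘(𝕜, EG) 𝓘(𝕜, E) ∞ G M]
    (hM : IsHamiltonianSpace G Ω μ) (hfree : IsLocallyFreeOnLevel (E := E) G μ ξ)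
    {p : M} (hp : μ p = ξ) : Function.Surjective (tderiv 𝕜 E (EG →L[𝕜] 𝕜) μ p) := by
  by_contra hns
  have hlt : LinearMap.range (tderiv 𝕜 E (EG →L[𝕜] 𝕜) μ p : E →ₗ[𝕜] EG →L[𝕜] 𝕜) < ⊤ :=
    lt_top_iff_ne_top.2 fun h => hns (LinearMap.range_eq_top.1 h)
  obtain ⟨f, hf0, hf⟩ := Submodule.exists_le_ker_of_lt_top _ hlt
  obtain ⟨x, hx⟩ := exists_eval_eq f
  have h1 : infinitesimalAction 𝕜 EG G E p x = 0 := by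
    refine hM.symplectic.eq_zero_of_form (p := p) fun w => ?_
    rw [hM.form_infinitesimalAction, ← hx]
    exact hf (LinearMap.mem_range_self _ w)
  have h2 : x = 0 := hM.injective_infinitesimalAction hfree hp (by rw [h1, map_zero])
  apply hf0
  ext η
  rw [hx, h2, map_zero, LinearMap.zero_apply]

/-- The symplectic orthogonal of `ker dμ_p` is the tangent space of the orbit. -/
theorem IsHamiltonianSpace.exists_infinitesimalAction_eq [FiniteDimensional 𝕜 EG]
    (hM : IsHamiltonianSpace G Ω μ) {p : M}
    (hp : Function.Surjective (tderiv 𝕜 E (EG →L[𝕜] 𝕜) μ p)) {v : E}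
    (hv : ∀ w, tderiv 𝕜 E (EG →L[𝕜] 𝕜) μ p w = 0 → Ω.form p ![v, w] = 0) :
    ∃ x, infinitesimalAction 𝕜 EG G E p x = v := by
  obtain ⟨s, hs⟩ :=
    (tderiv 𝕜 E (EG →L[𝕜] 𝕜) μ p : E →ₗ[𝕜] EG →L[𝕜] 𝕜).exists_rightInverse_of_surjective
    (LinearMap.range_eq_top.2 hp)
  -- since `Ω(v, ·)` vanishes on `ker dμ`, it factors through `dμ` as the evaluation at some `x`
  obtain ⟨x, hx⟩ := exists_eval_eq (contractLeft (Ω.form p) v ∘ₗ s)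
  refine ⟨x, sub_eq_zero.1 (hM.symplectic.eq_zero_of_form (p := p) fun w => ?_)⟩
  have h1 : Ω.form p ![v, w - s (tderiv 𝕜 E (EG →L[𝕜] 𝕜) μ p w)] = 0 := by
    refine hv _ ?_
    rw [map_sub, sub_eq_zero]
    exact (LinearMap.congr_fun hs _).symm
  rw [form_sub_right, sub_eq_zero] at h1
  rw [form_sub_left, hM.form_infinitesimalAction, ← hx, h1, LinearMap.comp_apply,
    contractLeft_apply, sub_self]

end Moment

/-! ### Orbits and stabilizers -/

section Orbits

variable {𝕜 : Type*} [RCLike 𝕜]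
  {EG : Type*} [NormedAddCommGroup EG] [NormedSpace 𝕜 EG] [FiniteDimensional 𝕜 EG]
  {G : Type*} [TopologicalSpace G] [ChartedSpace EG G] [Group G] [LieGroup 𝓘(𝕜, EG) ∞ G]
  {E : Type*} [NormedAddCommGroup E] [NormedSpace 𝕜 E]
  {M : Type*} [TopologicalSpace M] [ChartedSpace E M]
  [MulAction G M] [ContMDiffSMul 𝓘(𝕜, EG) 𝓘(𝕜, E) ∞ G M]

/-- A map from a finite-dimensional space into a single orbit of a second countable Lie group is
tangent to this orbit somewhere. By the Baire category theorem, some translate of a compact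
neighbourhood of `1`, acting on `p₀`, contains the image of an open set, and there the map lifts
to a differentiable map into the group. -/
theorem exists_tangent_to_orbit [SecondCountableTopology G] [FiniteDimensional 𝕜 E]
    [IsManifold 𝓘(𝕜, E) ∞ M] [T2Space M] {p₀ : M}
    (hinj : Function.Injective (infinitesimalAction 𝕜 EG G E p₀))
    {F : Type*} [NormedAddCommGroup F] [NormedSpace 𝕜 F] [FiniteDimensional 𝕜 F]
    {ψ : F → M} {U : Set F} (hU : U ∈ 𝓝 (0 : F))
    (hψ : ∀ u ∈ U, MDifferentiableAt 𝓘(𝕜, F) 𝓘(𝕜, E) ψ u)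
    (horb : ∀ u ∈ U, ψ u ∈ MulAction.orbit G p₀) :
    ∃ u ∈ U, ∀ s, ∃ x, tderiv 𝕜 F E ψ u s = infinitesimalAction 𝕜 EG G E (ψ u) x := by
  have : CompleteSpace F := FiniteDimensional.complete 𝕜 F
  have : LocallyCompactSpace G := Manifold.locallyCompact_of_finiteDimensional 𝓘(𝕜, EG)
  have : IsTopologicalGroup G := topologicalGroup_of_lieGroup 𝓘(𝕜, EG) ∞
  have ha : ContMDiff 𝓘(𝕜, EG) 𝓘(𝕜, E) ∞ (fun g : G => g • p₀) := contMDiff_smul_right 𝕜 EG G E p₀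
  obtain ⟨ρ, hρ, hρa⟩ := exists_local_leftInverse_of_tderiv_injective (ha 1) hinj
  have hN : {g : G | MDifferentiableAt 𝓘(𝕜, E) 𝓘(𝕜, EG) ρ (g • p₀) ∧ ρ (g • p₀) = g} ∈ 𝓝 1 :=
    ((ha 1).continuousAt.eventually (eventually_mdifferentiableAt_of_smooth hρ)).and hρa
  -- `C` is a compact neighbourhood of `1` on which the orbit map has the smooth left inverse `ρ`
  obtain ⟨C, hC1, hCN, hC⟩ := local_compact_nhds hN
  obtain ⟨D, hD, hDcov⟩ := TopologicalSpace.countable_cover_nhds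
    (f := fun g : G => (fun h => g⁻¹ * h) ⁻¹' C) fun g => by
      refine (continuous_const_mul g⁻¹).continuousAt.preimage_mem_nhds ?_
      simpa using hC1
  obtain ⟨r, hr, hrU⟩ := Metric.nhds_basis_closedBall.mem_iff.1 hU
  have : Countable D := hD
  -- countably many closed sets that cover `F`: the complement of a ball on which `ψ` takes its
  -- values in the orbit and, for each `d ∈ D`, the part of the ball that `ψ` maps into `d • C • p₀`
  let A : Option D → Set F := fun i => i.elim (Metric.ball 0 r)ᶜ fun d =>
    Metric.closedBall 0 r ∩ ψ ⁻¹' ((fun g : G => ((d : G) * g) • p₀) '' C)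
  have hAc : ∀ i, IsClosed (A i) := by
    rintro (_ | d)
    · exact Metric.isOpen_ball.isClosed_compl
    · have h1 : IsCompact ((fun g : G => ((d : G) * g) • p₀) '' C) :=
        hC.image (ha.continuous.comp (continuous_const_mul (d : G)))
      have h2 : ContinuousOn ψ (Metric.closedBall 0 r) := fun u hu =>
        (hψ u (hrU hu)).continuousAt.continuousWithinAt
      exact h2.preimage_isClosed_of_isClosed Metric.isClosed_closedBall h1.isClosed
  have hAu : ⋃ i, A i = univ := by
    refine eq_univ_of_forall fun u => ?_
    rw [mem_iUnion]
    by_cases hu : u ∈ Metric.ball (0 : F) r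
    · have hu' := Metric.ball_subset_closedBall hu
      obtain ⟨g, hg⟩ := horb u (hrU hu')
      have hg' : g ∈ ⋃ x ∈ D, (fun h => x⁻¹ * h) ⁻¹' C := hDcov ▸ mem_univ g
      obtain ⟨d, hd, hgd⟩ := mem_iUnion₂.1 hg'
      refine ⟨some ⟨d, hd⟩, hu', d⁻¹ * g, hgd, ?_⟩
      simpa using hg
    · exact ⟨none, hu⟩
  obtain ⟨u, hu, hui⟩ := (dense_iUnion_interior_of_closed hAc hAu).inter_open_nonempty
    _ Metric.isOpen_ball ⟨0, Metric.mem_ball_self hr⟩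
  obtain ⟨i, hi⟩ := mem_iUnion.1 hui
  rcases i with _ | d
  · exact absurd hu (interior_subset hi)
  have huU : u ∈ U := hrU (Metric.ball_subset_closedBall hu)
  refine ⟨u, huU, ?_⟩
  -- on `A (some d)` the map `ψ` lifts to `d * γ`
  let γ : F → G := ρ ∘ ((fun m => (d : G)⁻¹ • m) ∘ ψ)
  have hlift : ∀ u' ∈ A (some d), γ u' ∈ C ∧ ψ u' = ((d : G) * γ u') • p₀ := by
    rintro u' ⟨-, g, hg, hgu⟩
    have h1 : γ u' = g := by
      simp only [γ, Function.comp_apply, ← hgu, mul_smul, inv_smul_smul]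
      exact (hCN hg).2
    exact ⟨h1 ▸ hg, by rw [h1]; exact hgu.symm⟩
  obtain ⟨hγC, hψu⟩ := hlift u (interior_subset hi)
  have hγd : MDifferentiableAt 𝓘(𝕜, F) 𝓘(𝕜, EG) γ u := by
    have h1 : ((fun m => (d : G)⁻¹ • m) ∘ ψ) u = γ u • p₀ := by
      simp only [Function.comp_apply]
      rw [hψu, mul_smul, inv_smul_smul]
    refine MDifferentiableAt.comp u (I' := 𝓘(𝕜, E)) (by rw [h1]; exact (hCN hγC).1) ?_
    exact (mdifferentiableAt_of_smooth
      (contMDiff_smul_left 𝕜 EG E (d : G)⁻¹).contMDiffAt).comp u (hψ u huU)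
  set h : G := d * γ u with hh
  let κ : F → G := (fun g => (d : G) * g * h⁻¹) ∘ γ
  have hκ1 : κ u = 1 := by simp [κ, ← hh]
  have hκd : MDifferentiableAt 𝓘(𝕜, F) 𝓘(𝕜, EG) κ u := by
    have h1 : ContMDiff 𝓘(𝕜, EG) 𝓘(𝕜, EG) ∞ (fun g : G => (d : G) * g * h⁻¹) :=
      (contMDiff_const.mul contMDiff_id).mul contMDiff_const
    exact (mdifferentiableAt_of_smooth h1.contMDiffAt).comp u hγd
  have hev : ψ =ᶠ[𝓝 u] (fun g : G => g • ψ u) ∘ κ := by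
    filter_upwards [isOpen_interior.mem_nhds hi] with u' hu'
    rw [(hlift u' (interior_subset hu')).2, hψu]
    simp [κ, smul_smul]
  intro s
  refine ⟨tderiv 𝕜 F EG κ u s, ?_⟩
  rw [tderiv_congr hev, tderiv_comp hκ1
    (mdifferentiableAt_of_smooth (contMDiff_smul_right 𝕜 EG G E (ψ u)).contMDiffAt) hκd]
  rfl

variable {Ω : TwoForm 𝕜 E M} {μ : M → EG →L[𝕜] 𝕜} {ξ : EG →L[𝕜] 𝕜}

theorem finrank_range_comp_comp_le {V₁ V₂ V₃ V₄ : Type*} [AddCommGroup V₁] [Module 𝕜 V₁]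
    [AddCommGroup V₂] [Module 𝕜 V₂] [AddCommGroup V₃] [Module 𝕜 V₃] [AddCommGroup V₄] [Module 𝕜 V₄]
    [FiniteDimensional 𝕜 V₃] (A : V₃ →ₗ[𝕜] V₄) (B : V₂ →ₗ[𝕜] V₃) (R : V₁ →ₗ[𝕜] V₂) :
    Module.finrank 𝕜 (LinearMap.range (A ∘ₗ B ∘ₗ R)) ≤ Module.finrank 𝕜 (LinearMap.range B) := by
  have h : LinearMap.range (A ∘ₗ B ∘ₗ R) ≤ (LinearMap.range B).map A := by
    rintro _ ⟨v, rfl⟩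
    exact ⟨B (R v), ⟨R v, rfl⟩, rfl⟩
  exact (Submodule.finrank_mono h).trans (Submodule.finrank_map_le A _)

/-- Every `x ∈ 𝔤_ξ` is tangent at `1` to a curve in `G_ξ`: by equivariance the map
`g ↦ Ad^*_g ξ`, whose fibre through `1` is `G_ξ`, has constant rank. -/
theorem IsHamiltonianSpace.exists_curve_in_stabilizer (hM : IsHamiltonianSpace G Ω μ) {p : M}
    (hp : μ p = ξ) {x : EG} (hx : x ∈ coadjointStabilizerAlgebra G ξ) :
    ∃ c : 𝕜 → G, ContMDiffAt 𝓘(𝕜, 𝕜) 𝓘(𝕜, EG) ∞ c 0 ∧ c 0 = 1 ∧ tderiv 𝕜 𝕜 EG c 0 1 = x ∧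
      ∀ᶠ t in 𝓝 0, c t ∈ coadjointStabilizer G ξ := by
  let f : G → EG →L[𝕜] 𝕜 := fun g => coAd g ξ
  have hf : ContMDiff 𝓘(𝕜, EG) 𝓘(𝕜, EG →L[𝕜] 𝕜) ∞ f := by
    have h : f = μ ∘ fun g : G => g • p := funext fun g => (hM.moment_smul hp g).symm
    rw [h]
    exact hM.smooth_moment.comp (contMDiff_smul_right 𝕜 EG G E p)
  have hfd : ∀ g, MDifferentiableAt 𝓘(𝕜, EG) 𝓘(𝕜, EG →L[𝕜] 𝕜) f g := fun g =>
    mdifferentiableAt_of_smooth (hf g)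
  have hfx : tderiv 𝕜 EG (EG →L[𝕜] 𝕜) f 1 x = 0 := hx
  set e := extChartAt 𝓘(𝕜, EG) (1 : G)
  set a := e 1
  have he1 : e.symm a = 1 := extChartAt_to_inv 1
  have hesm : ∀ y ∈ e.target, ContMDiffAt 𝓘(𝕜, EG) 𝓘(𝕜, EG) ∞ e.symm y := fun y hy =>
    (contMDiffOn_extChartAt_symm (1 : G)).contMDiffAt ((isOpen_extChartAt_target _).mem_nhds hy)
  have hat : a ∈ e.target := mem_extChartAt_target 1
  have hec : ContMDiffAt 𝓘(𝕜, EG) 𝓘(𝕜, EG) ∞ e 1 := contMDiffAt_extChartAt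
  have hed : MDifferentiableAt 𝓘(𝕜, EG) 𝓘(𝕜, EG) e 1 := mdifferentiableAt_of_smooth hec
  have hef : e.symm ∘ e =ᶠ[𝓝 (1 : G)] id := by
    filter_upwards [extChartAt_source_mem_nhds (I := 𝓘(𝕜, EG)) (1 : G)] with g hg
    exact e.left_inv hg
  have hFd : ∀ y ∈ e.target, MDifferentiableAt 𝓘(𝕜, EG) 𝓘(𝕜, EG →L[𝕜] 𝕜) (f ∘ e.symm) y :=
    fun y hy => (hfd _).comp y (mdifferentiableAt_of_smooth (hesm y hy))
  have hf1 : tderiv 𝕜 EG (EG →L[𝕜] 𝕜) f 1 =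
      (fderiv 𝕜 (f ∘ e.symm) a).comp (tderiv 𝕜 EG EG e 1) := by
    have h1 : f =ᶠ[𝓝 1] (f ∘ e.symm) ∘ e := hef.mono fun g hg => congrArg f hg.symm
    rw [tderiv_congr h1, tderiv_comp (f := e) rfl (hFd a hat) hed, tderiv_eq_fderiv]
  -- equivariance: `f h = Ad^*_g (f (g⁻¹ h))`, so the rank of `f` at `g` is at most that at `1`
  have hrank : ∀ᶠ y in 𝓝 a,
      Module.finrank 𝕜 (LinearMap.range (fderiv 𝕜 (f ∘ e.symm) y : EG →ₗ[𝕜] EG →L[𝕜] 𝕜)) ≤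
      Module.finrank 𝕜 (LinearMap.range (fderiv 𝕜 (f ∘ e.symm) a : EG →ₗ[𝕜] EG →L[𝕜] 𝕜)) := by
    filter_upwards [(isOpen_extChartAt_target (1 : G)).mem_nhds hat] with y hy
    set g := e.symm y
    let L : (EG →L[𝕜] 𝕜) →L[𝕜] (EG →L[𝕜] 𝕜) :=
      (ContinuousLinearMap.compL 𝕜 EG EG 𝕜).flip (Ad 𝕜 g⁻¹)
    have h1 : f = L ∘ (f ∘ fun h => g⁻¹ * h) := by
      funext h
      change coAd h ξ = coAd g (coAd (g⁻¹ * h) ξ)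
      rw [← coAd_mul, mul_inv_cancel_left]
    have hmul : MDifferentiableAt 𝓘(𝕜, EG) 𝓘(𝕜, EG) (fun h : G => g⁻¹ * h) g := by
      have : ContMDiff 𝓘(𝕜, EG) 𝓘(𝕜, EG) ∞ (fun h : G => g⁻¹ * h) :=
        contMDiff_const.mul contMDiff_id
      exact mdifferentiableAt_of_smooth this.contMDiffAt
    have h2 : tderiv 𝕜 EG (EG →L[𝕜] 𝕜) f g =
        L.comp ((tderiv 𝕜 EG (EG →L[𝕜] 𝕜) f 1).comp (tderiv 𝕜 EG EG (fun h : G => g⁻¹ * h) g)) := by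
      conv_lhs => rw [h1]
      rw [tderiv_comp rfl L.hasFDerivAt.differentiableAt.mdifferentiableAt
        ((hfd _).comp g hmul), L.hasFDerivAt.tderiv,
        tderiv_comp (f := fun h : G => g⁻¹ * h) (inv_mul_cancel g) (hfd 1) hmul]
    have h3 : fderiv 𝕜 (f ∘ e.symm) y = L.comp ((fderiv 𝕜 (f ∘ e.symm) a).comp
        ((tderiv 𝕜 EG EG e 1).comp ((tderiv 𝕜 EG EG (fun h : G => g⁻¹ * h) g).comp
          (tderiv 𝕜 EG EG e.symm y)))) := by
      rw [← tderiv_eq_fderiv, tderiv_comp rfl (hfd _) (mdifferentiableAt_of_smooth (hesm y hy)),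
        h2, hf1]
      rfl
    rw [h3]
    exact finrank_range_comp_comp_le (L : (EG →L[𝕜] 𝕜) →ₗ[𝕜] (EG →L[𝕜] 𝕜))
      (fderiv 𝕜 (f ∘ e.symm) a : EG →ₗ[𝕜] (EG →L[𝕜] 𝕜)) _
  have hFa : ContDiffAt 𝕜 ∞ (f ∘ e.symm) a :=
    ((hf _).comp a (hesm a hat)).contDiffAt
  obtain ⟨c, hc, hc0, hcx, hcf⟩ := exists_curve_in_fiber hFa hrank
    (x := tderiv 𝕜 EG EG e 1 x) (by
      rw [← ContinuousLinearMap.comp_apply, ← hf1, hfx])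
  have hea : ContMDiffAt 𝓘(𝕜, EG) 𝓘(𝕜, EG) ∞ e.symm (c 0) := by
    rw [hc0]; exact hesm a hat
  refine ⟨e.symm ∘ c, hea.comp 0 hc.contMDiffAt, by simp [hc0, he1], ?_, ?_⟩
  · rw [tderiv_comp hc0 (mdifferentiableAt_of_smooth (hesm a hat))
      (mdifferentiableAt_of_smooth hc.contMDiffAt), tderiv_eq_fderiv,
      ContinuousLinearMap.comp_apply, hcx, ← ContinuousLinearMap.comp_apply,
      ← tderiv_comp (f := e) rfl (mdifferentiableAt_of_smooth (hesm a hat)) hed, tderiv_eq_id hef,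
      ContinuousLinearMap.id_apply]
  · filter_upwards [hcf] with t ht
    change f (e.symm (c t)) = ξ
    have h1 : f (e.symm (c t)) = f (e.symm a) := ht
    rw [h1, he1]
    exact coAd_one ξ

end Orbits

/-! ### Descent of forms along a submersion -/

section Descent

variable {𝕜 : Type*} [RCLike 𝕜]
  {X : Type*} [NormedAddCommGroup X] [NormedSpace 𝕜 X]
  {P : Type*} [TopologicalSpace P] [ChartedSpace X P]
  {Y : Type*} [NormedAddCommGroup Y] [NormedSpace 𝕜 Y]
  {Q : Type*} [TopologicalSpace Q] [ChartedSpace Y Q]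
  {E : Type*} [NormedAddCommGroup E] [NormedSpace 𝕜 E]
  {M : Type*} [TopologicalSpace M] [ChartedSpace E M]

theorem _root_.Manifold.IsSubmersion.surjective_tderiv {π : P → Q}
    (hπ : Manifold.IsSubmersion 𝓘(𝕜, X) 𝓘(𝕜, Y) ∞ π) (p : P) :
    Function.Surjective (tderiv 𝕜 X Y π p) := by
  obtain ⟨F, _, _, hF⟩ := hπ
  obtain ⟨σ, hσ, hσp, hσπ⟩ := (hF p).exists_local_section
  intro w
  refine ⟨tderiv 𝕜 Y X σ (π p) w, ?_⟩
  rw [← ContinuousLinearMap.comp_apply, ← tderiv_comp hσp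
    (mdifferentiableAt_of_smooth hF.contMDiff.contMDiffAt) (mdifferentiableAt_of_smooth hσ),
    tderiv_eq_id (f := π ∘ σ) hσπ, ContinuousLinearMap.id_apply]

/-- A 2-form on `P` descends along a surjective submersion `π : P → Q` if it annihilates the
vertical vectors and any two points of a fibre are related by a map over `Q` that preserves the
form. -/
theorem existsUnique_eq_pullback {π : P → Q} (hπ : Manifold.IsSubmersion 𝓘(𝕜, X) 𝓘(𝕜, Y) ∞ π)
    (hsurj : Function.Surjective π) {β : TwoForm 𝕜 X P}
    (hvert : ∀ p u w, tderiv 𝕜 X Y π p u = 0 → β.form p ![u, w] = 0)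
    (htrans : ∀ p p', π p = π p' → ∃ τ : P → P, ContMDiff 𝓘(𝕜, X) 𝓘(𝕜, X) ∞ τ ∧ τ p = p' ∧
      π ∘ τ = π ∧ TwoForm.pullback (E := X) τ β = β) :
    ∃! β' : TwoForm 𝕜 Y Q, β = TwoForm.pullback (E := X) π β' := by
  have hπd : ∀ p, MDifferentiableAt 𝓘(𝕜, X) 𝓘(𝕜, Y) π p := fun p =>
    mdifferentiableAt_of_smooth hπ.contMDiff.contMDiffAt
  refine existsUnique_of_exists_of_unique ?_ fun β₁ β₂ h₁ h₂ => ?_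
  · have hsec : ∀ q : Q, ∃ (p : P) (σ : Q → P), π p = q ∧
        MDifferentiableAt 𝓘(𝕜, Y) 𝓘(𝕜, X) σ q ∧ σ q = p ∧ ∀ᶠ q' in 𝓝 q, π (σ q') = q' := by
      obtain ⟨F, _, _, hF⟩ := hπ
      intro q
      obtain ⟨p, rfl⟩ := hsurj q
      obtain ⟨σ, hσ, hσp, hσπ⟩ := (hF p).exists_local_section
      exact ⟨p, σ, rfl, mdifferentiableAt_of_smooth hσ, hσp, hσπ⟩
    choose a σ ha hσ hσa hσπ using hsec
    let β' : TwoForm 𝕜 Y Q := fun q => TwoForm.pullback (E := Y) (σ q) β q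
    have hβ' : ∀ q, β'.form q = (TwoForm.pullback (E := Y) (σ q) β).form q := fun _ => rfl
    refine ⟨β', funext fun p => ?_⟩
    have hform : ∀ v v' w w', tderiv 𝕜 X Y π (a (π p)) v = tderiv 𝕜 X Y π (a (π p)) v' →
        tderiv 𝕜 X Y π (a (π p)) w = tderiv 𝕜 X Y π (a (π p)) w' →
        β.form (a (π p)) ![v, w] = β.form (a (π p)) ![v', w'] := by
      intro v v' w w' hv hw
      have h1 := hvert (a (π p)) (v - v') w (by rw [map_sub, hv, sub_self])
      have h2 := hvert (a (π p)) (w - w') v' (by rw [map_sub, hw, sub_self])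
      rw [form_sub_left, sub_eq_zero] at h1
      rw [form_sub_left, sub_eq_zero] at h2
      rw [h1, form_swap, h2, ← form_swap]
    -- both `dτ v` and `dσ (dπ v)` are lifts of `dπ v` to the point `a (π p)`
    obtain ⟨τ, hτ, hτp, hπτ, hτβ⟩ := htrans p (a (π p)) (ha _).symm
    have hτd := mdifferentiableAt_of_smooth (hτ.contMDiffAt (x := p))
    have h1 : (tderiv 𝕜 X Y π (a (π p))).comp (tderiv 𝕜 X X τ p) = tderiv 𝕜 X Y π p := by
      rw [← tderiv_comp hτp (hπd _) hτd, hπτ]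
    have h2 : (tderiv 𝕜 X Y π (a (π p))).comp (tderiv 𝕜 Y X (σ (π p)) (π p)) =
        ContinuousLinearMap.id 𝕜 Y := by
      rw [← tderiv_comp (hσa _) (hπd _) (hσ _), tderiv_eq_id (f := π ∘ σ (π p)) (hσπ _)]
    change β.form p = (TwoForm.pullback (E := X) π β').form p
    refine form_ext fun v w => ?_
    have h3 : β.form p ![v, w] =
        β.form (a (π p)) ![tderiv 𝕜 X X τ p v, tderiv 𝕜 X X τ p w] := by
      rw [← hτp, ← TwoForm.form_pullback_apply, hτβ]
    rw [TwoForm.form_pullback_apply, hβ', TwoForm.form_pullback_apply, hσa, h3]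
    have key : ∀ v, tderiv 𝕜 X Y π (a (π p)) (tderiv 𝕜 X X τ p v) =
        tderiv 𝕜 X Y π (a (π p)) (tderiv 𝕜 Y X (σ (π p)) (π p) (tderiv 𝕜 X Y π p v)) := fun v =>
      (DFunLike.congr_fun h1 v).trans (DFunLike.congr_fun h2 (tderiv 𝕜 X Y π p v)).symm
    exact hform _ _ _ _ (key v) (key w)
  · funext q
    obtain ⟨p, rfl⟩ := hsurj q
    change TwoForm.form β₁ (π p) = TwoForm.form β₂ (π p)
    refine form_ext fun v w => ?_
    obtain ⟨v', rfl⟩ := hπ.surjective_tderiv p v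
    obtain ⟨w', rfl⟩ := hπ.surjective_tderiv p w
    rw [← TwoForm.form_pullback_apply, ← TwoForm.form_pullback_apply, ← h₁, ← h₂]

/-- If `j^* Ω = π^* Ω'` for a symplectic form `Ω` and a surjective submersion `π`, then `Ω'` is
symplectic as soon as the kernel of `j^* Ω` consists of vertical vectors. -/
theorem isSymplectic_of_pullback_eq [IsManifold 𝓘(𝕜, E) ∞ M] [IsManifold 𝓘(𝕜, Y) ∞ Q]
    [IsManifold 𝓘(𝕜, X) ∞ P]
    {j : P → M} (hj : ContMDiff 𝓘(𝕜, X) 𝓘(𝕜, E) ∞ j)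
    {π : P → Q} (hπ : Manifold.IsSubmersion 𝓘(𝕜, X) 𝓘(𝕜, Y) ∞ π) (hsurj : Function.Surjective π)
    {Ω : TwoForm 𝕜 E M} (hΩ : IsSymplectic Ω) {Ω' : TwoForm 𝕜 Y Q}
    (h : TwoForm.pullback (E := X) j Ω = TwoForm.pullback (E := X) π Ω')
    (hker : ∀ p v, (∀ w, (TwoForm.pullback (E := X) j Ω).form p ![v, w] = 0) →
      tderiv 𝕜 X Y π p v = 0) : IsSymplectic Ω' := by
  have hloc : ∀ q : Q, ∃ s : Q → M, ContMDiffAt 𝓘(𝕜, Y) 𝓘(𝕜, E) ∞ s q ∧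
      ∀ᶠ q' in 𝓝 q, Ω'.form q' = (TwoForm.pullback (E := Y) s Ω).form q' := by
    have hπ' := hπ
    obtain ⟨F, _, _, hF⟩ := hπ'
    intro q
    obtain ⟨p, rfl⟩ := hsurj q
    obtain ⟨σ, hσ, -, hσπ⟩ := (hF p).exists_local_section
    refine ⟨j ∘ σ, hj.contMDiffAt.comp _ hσ, ?_⟩
    filter_upwards [eventually_mdifferentiableAt_of_smooth hσ, hσπ.eventually_nhds] with q' hd hid
    rw [TwoForm.form_pullback_comp Ω (mdifferentiableAt_of_smooth hj.contMDiffAt) hd, h,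
      ← TwoForm.form_pullback_comp Ω' (mdifferentiableAt_of_smooth hπ.contMDiff.contMDiffAt) hd,
      TwoForm.form_pullback_id (f := π ∘ σ) Ω' hid]
  refine ⟨fun x₀ y hy => ?_, fun x₀ y hy => ?_, fun q v hv => ?_⟩
  · exact (contDiffAt_and_extDeriv_eq_zero_of_locally_pullback hΩ hloc x₀ hy).1.contDiffWithinAt
  · exact (contDiffAt_and_extDeriv_eq_zero_of_locally_pullback hΩ hloc x₀ hy).2
  · obtain ⟨p, rfl⟩ := hsurj q
    obtain ⟨v', hv'⟩ := hπ.surjective_tderiv p v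
    rw [← hv']
    refine hker p v' fun w => ?_
    rw [h, TwoForm.form_pullback_apply, hv']
    exact hv _

end Descent

/-! ### The level set of the moment map and its quotient -/

section MomentLevel

variable {𝕜 : Type*} [RCLike 𝕜]
  {EG : Type*} [NormedAddCommGroup EG] [NormedSpace 𝕜 EG]
  {G : Type*} [TopologicalSpace G] [ChartedSpace EG G] [Group G]
  {E : Type*} [NormedAddCommGroup E] [NormedSpace 𝕜 E]
  {M : Type*} [TopologicalSpace M] [ChartedSpace E M] [MulAction G M]
  {Ω : TwoForm 𝕜 E M} {μ : M → EG →L[𝕜] 𝕜} {ξ : EG →L[𝕜] 𝕜}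

/-- The level set of the moment map carries the structure of an embedded submanifold. In the proof
its dimension is `dim M - dim G`, except that an empty level set is given dimension `0`, as
`dim M < dim G` is possible then. -/
theorem IsHamiltonianSpace.exists_manifold_structure_levelSet [FiniteDimensional 𝕜 EG]
    [FiniteDimensional 𝕜 E] [ContMDiffSMul 𝓘(𝕜, EG) 𝓘(𝕜, E) ∞ G M] [IsManifold 𝓘(𝕜, E) ∞ M]
    (hM : IsHamiltonianSpace G Ω μ) (hfree : IsLocallyFreeOnLevel (E := E) G μ ξ) :
    ∃ (d : ℕ) (_ : ChartedSpace (EuclideanSpace 𝕜 (Fin d)) (LevelSet μ ξ)),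
      IsManifold 𝓘(𝕜, EuclideanSpace 𝕜 (Fin d)) ∞ (LevelSet μ ξ) ∧
      Manifold.IsSmoothEmbedding 𝓘(𝕜, EuclideanSpace 𝕜 (Fin d)) 𝓘(𝕜, E) ∞
        (levelInclusion μ ξ) := by
  have hreg : ∀ p, μ p = ξ → Function.Surjective (tderiv 𝕜 E (EG →L[𝕜] 𝕜) μ p) := fun p hp =>
    hM.surjective_tderiv_moment hfree hp
  rcases isEmpty_or_nonempty (LevelSet μ ξ) with hempty | ⟨⟨p⟩⟩
  · let cs : ChartedSpace (EuclideanSpace 𝕜 (Fin 0)) (LevelSet μ ξ) := ChartedSpace.empty _ _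
    exact ⟨0, cs, isManifold_of_contDiffOn _ _ _ fun e _ he => he.elim,
      ⟨⟨PUnit, inferInstance, inferInstance, fun p => hempty.elim p⟩,
        Topology.IsEmbedding.subtypeVal⟩⟩
  · have hle : Module.finrank 𝕜 (EG →L[𝕜] 𝕜) ≤ Module.finrank 𝕜 E :=
      LinearMap.finrank_le_finrank_of_surjective
        (f := (tderiv 𝕜 E (EG →L[𝕜] 𝕜) μ p : E →ₗ[𝕜] EG →L[𝕜] 𝕜)) (hreg p p.2)
    let d := Module.finrank 𝕜 E - Module.finrank 𝕜 (EG →L[𝕜] 𝕜)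
    have hdim : Module.finrank 𝕜 (EuclideanSpace 𝕜 (Fin d) × (EG →L[𝕜] 𝕜)) =
        Module.finrank 𝕜 E := by
      rw [Module.finrank_prod, finrank_euclideanSpace_fin, Nat.sub_add_cancel hle]
    exact ⟨d, exists_manifold_structure_level hM.smooth_moment ξ
      (ContinuousLinearEquiv.ofFinrankEq hdim) hreg⟩

/-- Vectors tangent to `μ⁻¹(ξ)` are annihilated by `dμ`. -/
theorem IsHamiltonianSpace.tderiv_moment_levelInclusion (hM : IsHamiltonianSpace G Ω μ)
    {X : Type*} [NormedAddCommGroup X] [NormedSpace 𝕜 X] [ChartedSpace X (LevelSet μ ξ)]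
    (hj : Manifold.IsSmoothEmbedding 𝓘(𝕜, X) 𝓘(𝕜, E) ∞ (levelInclusion μ ξ))
    (p : LevelSet μ ξ) (u : X) :
    tderiv 𝕜 E (EG →L[𝕜] 𝕜) μ p (tderiv 𝕜 X E (levelInclusion μ ξ) p u) = 0 := by
  have h : μ ∘ levelInclusion μ ξ = fun _ => ξ := funext fun p => p.2
  have h1 : tderiv 𝕜 X (EG →L[𝕜] 𝕜) (μ ∘ levelInclusion μ ξ) p = 0 :=
    tderiv_eq_zero (c := ξ) (by rw [h])
  rw [tderiv_comp (f := levelInclusion μ ξ) (y := (p : M)) rfl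
    (mdifferentiableAt_of_smooth hM.smooth_moment.contMDiffAt)
    (mdifferentiableAt_of_smooth (hj.contMDiff p))] at h1
  exact DFunLike.congr_fun h1 u

end MomentLevel

section ReducedSpace

variable {𝕜 : Type*} [RCLike 𝕜]
  {EG : Type*} [NormedAddCommGroup EG] [NormedSpace 𝕜 EG]
  {G : Type*} [TopologicalSpace G] [ChartedSpace EG G] [Group G] [LieGroup 𝓘(𝕜, EG) ∞ G]
  {E : Type*} [NormedAddCommGroup E] [NormedSpace 𝕜 E]
  {M : Type*} [TopologicalSpace M] [ChartedSpace E M]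
  [MulAction G M]
  {Ω : TwoForm 𝕜 E M} {μ : M → EG →L[𝕜] 𝕜} {ξ : EG →L[𝕜] 𝕜}

/-- The action of an element of `G_ξ` on `μ⁻¹(ξ)`. -/
def IsHamiltonianSpace.levelTranslation (hM : IsHamiltonianSpace G Ω μ)
    (g : coadjointStabilizer G ξ) (p : LevelSet μ ξ) : LevelSet μ ξ :=
  ⟨(g : G) • (p : M), (hM.moment_smul p.2 g).trans g.2⟩

theorem levelProjection_eq_iff {p p' : LevelSet μ ξ} :
    levelProjection G μ ξ p = levelProjection G μ ξ p' ↔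
      ∃ g ∈ coadjointStabilizer G ξ, g • (p' : M) = p := by
  refine Quotient.eq.trans ⟨fun ⟨g, hg⟩ => ⟨g, g.2, hg⟩, fun ⟨g, hg, h⟩ => ⟨⟨g, hg⟩, h⟩⟩

theorem IsHamiltonianSpace.levelProjection_comp_levelTranslation (hM : IsHamiltonianSpace G Ω μ)
    (g : coadjointStabilizer G ξ) :
    levelProjection G μ ξ ∘ hM.levelTranslation g = levelProjection G μ ξ :=
  funext fun _ => levelProjection_eq_iff.2 ⟨g, g.2, rfl⟩

end ReducedSpace

section Reduction

variable {𝕜 : Type*} [RCLike 𝕜]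
  {EG : Type*} [NormedAddCommGroup EG] [NormedSpace 𝕜 EG]
  {G : Type*} [TopologicalSpace G] [ChartedSpace EG G] [Group G] [LieGroup 𝓘(𝕜, EG) ∞ G]
  {E : Type*} [NormedAddCommGroup E] [NormedSpace 𝕜 E]
  {M : Type*} [TopologicalSpace M] [ChartedSpace E M]
  [MulAction G M] [ContMDiffSMul 𝓘(𝕜, EG) 𝓘(𝕜, E) ∞ G M]
  {Ω : TwoForm 𝕜 E M} {μ : M → EG →L[𝕜] 𝕜} {ξ : EG →L[𝕜] 𝕜}
  {X : Type*} [NormedAddCommGroup X] [NormedSpace 𝕜 X] [ChartedSpace X (LevelSet μ ξ)]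

theorem IsHamiltonianSpace.contMDiff_levelTranslation [IsManifold 𝓘(𝕜, X) ∞ (LevelSet μ ξ)]
    (hM : IsHamiltonianSpace G Ω μ)
    (hj : Manifold.IsSmoothEmbedding 𝓘(𝕜, X) 𝓘(𝕜, E) ∞ (levelInclusion μ ξ))
    (g : coadjointStabilizer G ξ) :
    ContMDiff 𝓘(𝕜, X) 𝓘(𝕜, X) ∞ (hM.levelTranslation g) := fun p =>
  hj.contMDiffAt_of_comp (((contMDiff_smul_left 𝕜 EG E (g : G)).comp hj.contMDiff) p)

theorem IsHamiltonianSpace.pullback_levelTranslation [IsManifold 𝓘(𝕜, X) ∞ (LevelSet μ ξ)]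
    (hM : IsHamiltonianSpace G Ω μ)
    (hj : Manifold.IsSmoothEmbedding 𝓘(𝕜, X) 𝓘(𝕜, E) ∞ (levelInclusion μ ξ))
    (g : coadjointStabilizer G ξ) :
    TwoForm.pullback (E := X) (hM.levelTranslation g)
      (TwoForm.pullback (E := X) (levelInclusion μ ξ) Ω) =
      TwoForm.pullback (E := X) (levelInclusion μ ξ) Ω := by
  funext p
  change (TwoForm.pullback (E := X) (hM.levelTranslation g) _).form p =
    (TwoForm.pullback (E := X) (levelInclusion μ ξ) Ω).form p
  have hjd : ∀ p, MDifferentiableAt 𝓘(𝕜, X) 𝓘(𝕜, E) (levelInclusion μ ξ) p := fun p =>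
    mdifferentiableAt_of_smooth (hj.contMDiff p)
  have h : levelInclusion μ ξ ∘ hM.levelTranslation g =
      (fun m : M => (g : G) • m) ∘ levelInclusion μ ξ := rfl
  rw [← TwoForm.form_pullback_comp Ω (hjd _)
    (mdifferentiableAt_of_smooth (hM.contMDiff_levelTranslation hj g p)), h,
    TwoForm.form_pullback_comp Ω
      (mdifferentiableAt_of_smooth (contMDiff_smul_left 𝕜 EG E (g : G)).contMDiffAt) (hjd p),
    hM.invariant]

variable {Y : Type*} [NormedAddCommGroup Y] [NormedSpace 𝕜 Y] [ChartedSpace Y (ReducedSpace G μ ξ)]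

/-- A vector tangent to `μ⁻¹(ξ)` that is the value of a generating vector field of `𝔤_ξ` is vertical
for the projection: it is the velocity of a curve in a `G_ξ`-orbit. -/
theorem IsHamiltonianSpace.tderiv_levelProjection_eq_zero [FiniteDimensional 𝕜 EG]
    [IsManifold 𝓘(𝕜, X) ∞ (LevelSet μ ξ)] (hM : IsHamiltonianSpace G Ω μ)
    (hj : Manifold.IsSmoothEmbedding 𝓘(𝕜, X) 𝓘(𝕜, E) ∞ (levelInclusion μ ξ))
    (hπ : ContMDiff 𝓘(𝕜, X) 𝓘(𝕜, Y) ∞ (levelProjection G μ ξ)) {p : LevelSet μ ξ} {u : X} {x : EG}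
    (hx : x ∈ coadjointStabilizerAlgebra G ξ)
    (hu : tderiv 𝕜 X E (levelInclusion μ ξ) p u = infinitesimalAction 𝕜 EG G E (p : M) x) :
    tderiv 𝕜 X Y (levelProjection G μ ξ) p u = 0 := by
  obtain ⟨c, hc, hc0, hcx, hcs⟩ := hM.exists_curve_in_stabilizer p.2 hx
  have ha : ContMDiffAt 𝓘(𝕜, EG) 𝓘(𝕜, E) ∞ (fun g : G => g • (p : M)) (c 0) :=
    (contMDiff_smul_right 𝕜 EG G E (p : M)).contMDiffAt
  have hγ : ContMDiffAt 𝓘(𝕜, 𝕜) 𝓘(𝕜, E) ∞ ((fun g : G => g • (p : M)) ∘ c) 0 := ha.comp 0 hc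
  obtain ⟨b, hb, hjb⟩ := hj.exists_lift hγ (hcs.mono fun t ht =>
    ⟨hM.levelTranslation ⟨c t, ht⟩ p, rfl⟩)
  have hb0 : b 0 = p := hj.isEmbedding.injective <| by
    refine hjb.self_of_nhds.trans ?_
    simp [hc0, levelInclusion]
  have hbd := mdifferentiableAt_of_smooth hb
  have hjd := mdifferentiableAt_of_smooth (hj.contMDiff p)
  have hb1 : tderiv 𝕜 𝕜 X b 0 1 = u := by
    obtain ⟨r, hr, hrj⟩ := (hj.isImmersion.isImmersionAt p).exists_local_leftInverse
    refine tderiv_injective_of_local_leftInverse hjd (mdifferentiableAt_of_smooth hr) hrj ?_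
    rw [hu, ← ContinuousLinearMap.comp_apply, ← tderiv_comp hb0 hjd hbd, tderiv_congr hjb,
      tderiv_comp hc0 (mdifferentiableAt_of_smooth
        (contMDiff_smul_right 𝕜 EG G E (p : M)).contMDiffAt) (mdifferentiableAt_of_smooth hc),
      ContinuousLinearMap.comp_apply, hcx]
    rfl
  have hconst : levelProjection G μ ξ ∘ b =ᶠ[𝓝 0] fun _ => levelProjection G μ ξ p := by
    filter_upwards [hjb, hcs] with t ht hts
    exact levelProjection_eq_iff.2 ⟨c t, hts, ht.symm⟩
  rw [← hb1, ← ContinuousLinearMap.comp_apply,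
    ← tderiv_comp hb0 (mdifferentiableAt_of_smooth hπ.contMDiffAt) hbd, tderiv_eq_zero hconst,
    zero_apply]

/-- The kernel of `j^* Ω` consists of vertical vectors: it is the intersection of the tangent spaces
of `μ⁻¹(ξ)` and of the `G`-orbit, which is the tangent space of the `G_ξ`-orbit. -/
theorem IsHamiltonianSpace.tderiv_levelProjection_eq_zero_of_form [FiniteDimensional 𝕜 EG]
    [FiniteDimensional 𝕜 E] [IsManifold 𝓘(𝕜, E) ∞ M]
    [IsManifold 𝓘(𝕜, X) ∞ (LevelSet μ ξ)] (hM : IsHamiltonianSpace G Ω μ)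
    (hfree : IsLocallyFreeOnLevel (E := E) G μ ξ)
    (hj : Manifold.IsSmoothEmbedding 𝓘(𝕜, X) 𝓘(𝕜, E) ∞ (levelInclusion μ ξ))
    (hπ : ContMDiff 𝓘(𝕜, X) 𝓘(𝕜, Y) ∞ (levelProjection G μ ξ)) {p : LevelSet μ ξ} {v : X}
    (hv : ∀ w, (TwoForm.pullback (E := X) (levelInclusion μ ξ) Ω).form p ![v, w] = 0) :
    tderiv 𝕜 X Y (levelProjection G μ ξ) p v = 0 := by
  have hs := hM.surjective_tderiv_moment hfree p.2
  obtain ⟨x, hx⟩ := hM.exists_infinitesimalAction_eq hs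
    (v := tderiv 𝕜 X E (levelInclusion μ ξ) p v) fun w hw => by
      obtain ⟨u, rfl⟩ := exists_tderiv_eq_of_tderiv_eq_zero hM.smooth_moment ξ hj p hs hw
      have h := hv u
      rw [TwoForm.form_pullback_apply] at h
      exact h
  refine hM.tderiv_levelProjection_eq_zero hj hπ
    ((hM.mem_coadjointStabilizerAlgebra_iff p.2 x).2 ?_) hx.symm
  rw [hx, hM.tderiv_moment_levelInclusion hj]

/-- Vertical vectors lie in the kernel of `j^* Ω`. At some point of the fibre through `p` every
vertical vector is tangent to a `G`-orbit, so it pairs to zero with `ker dμ`; translation by `G_ξ`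
carries this back to `p`. -/
theorem IsHamiltonianSpace.form_eq_zero_of_tderiv_levelProjection [FiniteDimensional 𝕜 EG]
    [FiniteDimensional 𝕜 E] [IsManifold 𝓘(𝕜, E) ∞ M] [FiniteDimensional 𝕜 X]
    [SecondCountableTopology G] [T2Space M] [IsManifold 𝓘(𝕜, X) ∞ (LevelSet μ ξ)]
    (hM : IsHamiltonianSpace G Ω μ) (hfree : IsLocallyFreeOnLevel (E := E) G μ ξ)
    (hj : Manifold.IsSmoothEmbedding 𝓘(𝕜, X) 𝓘(𝕜, E) ∞ (levelInclusion μ ξ))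
    (hπ : Manifold.IsSubmersion 𝓘(𝕜, X) 𝓘(𝕜, Y) ∞ (levelProjection G μ ξ)) (p : LevelSet μ ξ)
    (v w : X) (hv : tderiv 𝕜 X Y (levelProjection G μ ξ) p v = 0) :
    (TwoForm.pullback (E := X) (levelInclusion μ ξ) Ω).form p ![v, w] = 0 := by
  have hπs := hπ.contMDiff
  have hjd : ∀ q, MDifferentiableAt 𝓘(𝕜, X) 𝓘(𝕜, E) (levelInclusion μ ξ) q := fun q =>
    mdifferentiableAt_of_smooth (hj.contMDiff q)
  obtain ⟨F, _, _, hF⟩ := hπ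
  have : FiniteDimensional 𝕜 F := by
    have e := (hF p).equiv
    have : FiniteDimensional 𝕜 (Y × F) := LinearEquiv.finiteDimensional e.toLinearEquiv
    exact FiniteDimensional.of_surjective (LinearMap.snd 𝕜 Y F) LinearMap.snd_surjective
  obtain ⟨ψ, hψ⟩ := (hF p).exists_fiber_parametrization
  obtain ⟨u, ⟨hψu, hπu, hvert⟩, hu⟩ := exists_tangent_to_orbit
    (hM.injective_infinitesimalAction hfree p.2) (ψ := levelInclusion μ ξ ∘ ψ) hψ
    (fun u hu => (hjd _).comp u (mdifferentiableAt_of_smooth hu.1)) (fun u hu => by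
      obtain ⟨g, -, hg⟩ := levelProjection_eq_iff.1 hu.2.1
      exact ⟨g, hg⟩)
  obtain ⟨g, hg, hgu⟩ := levelProjection_eq_iff.1 hπu
  set τ := hM.levelTranslation ⟨g, hg⟩ with hτ
  have hτp : τ p = ψ u := Subtype.ext hgu
  have hτd := mdifferentiableAt_of_smooth (hM.contMDiff_levelTranslation hj ⟨g, hg⟩ p)
  obtain ⟨s, hs⟩ := hvert (tderiv 𝕜 X X τ p v) (by
    rw [← ContinuousLinearMap.comp_apply,
      ← tderiv_comp hτp (mdifferentiableAt_of_smooth hπs.contMDiffAt) hτd,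
      hM.levelProjection_comp_levelTranslation, hv])
  obtain ⟨x, hx⟩ := hu s
  rw [tderiv_comp rfl (hjd _) (mdifferentiableAt_of_smooth hψu), ContinuousLinearMap.comp_apply,
    hs] at hx
  rw [← hM.pullback_levelTranslation hj ⟨g, hg⟩, TwoForm.form_pullback_apply, ← hτ, hτp,
    TwoForm.form_pullback_apply, hx, Function.comp_apply, hM.form_infinitesimalAction]
  exact DFunLike.congr_fun (hM.tderiv_moment_levelInclusion hj (ψ u) (tderiv 𝕜 X X τ p w)) x

end Reduction

end HamiltonianReduction

end

open HamiltonianReduction in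
theorem mainTheorem2
    {𝕜 : Type*} [RCLike 𝕜]
    -- the Lie group
    {EG : Type*} [NormedAddCommGroup EG] [NormedSpace 𝕜 EG] [FiniteDimensional 𝕜 EG]
    {G : Type*} [TopologicalSpace G] [ChartedSpace EG G] [Group G] [LieGroup 𝓘(𝕜, EG) ∞ G]
    [T2Space G] [SecondCountableTopology G]
    -- the Hamiltonian space
    {E : Type*} [NormedAddCommGroup E] [NormedSpace 𝕜 E] [FiniteDimensional 𝕜 E]
    {M : Type*} [TopologicalSpace M] [ChartedSpace E M] [IsManifold 𝓘(𝕜, E) ∞ M]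
    [T2Space M] [SecondCountableTopology M]
    [MulAction G M] [ContMDiffSMul 𝓘(𝕜, EG) 𝓘(𝕜, E) ∞ G M]
    (Ω : TwoForm 𝕜 E M) (μ : M → EG →L[𝕜] 𝕜) (hM : IsHamiltonianSpace G Ω μ)
    (ξ : EG →L[𝕜] 𝕜) (hfree : IsLocallyFreeOnLevel (E := E) G μ ξ) :
    -- the level set is an embedded submanifold
    (∃ (d : ℕ) (_ : ChartedSpace (EuclideanSpace 𝕜 (Fin d)) (LevelSet μ ξ)),
      IsManifold 𝓘(𝕜, EuclideanSpace 𝕜 (Fin d)) ∞ (LevelSet μ ξ) ∧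
      Manifold.IsSmoothEmbedding 𝓘(𝕜, EuclideanSpace 𝕜 (Fin d)) 𝓘(𝕜, E) ∞
        (levelInclusion μ ξ)) ∧
    -- for its submanifold structure, and whenever the quotient is a manifold
    ∀ (d : ℕ) [ChartedSpace (EuclideanSpace 𝕜 (Fin d)) (LevelSet μ ξ)]
      [IsManifold 𝓘(𝕜, EuclideanSpace 𝕜 (Fin d)) ∞ (LevelSet μ ξ)],
      Manifold.IsSmoothEmbedding 𝓘(𝕜, EuclideanSpace 𝕜 (Fin d)) 𝓘(𝕜, E) ∞
        (levelInclusion μ ξ) →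
    ∀ (k : ℕ) [ChartedSpace (EuclideanSpace 𝕜 (Fin k)) (ReducedSpace G μ ξ)]
      [IsManifold 𝓘(𝕜, EuclideanSpace 𝕜 (Fin k)) ∞ (ReducedSpace G μ ξ)]
      [T2Space (ReducedSpace G μ ξ)],
      Manifold.IsSubmersion 𝓘(𝕜, EuclideanSpace 𝕜 (Fin d)) 𝓘(𝕜, EuclideanSpace 𝕜 (Fin k)) ∞
        (levelProjection G μ ξ) →
    ∃! Ωbar : TwoForm 𝕜 (EuclideanSpace 𝕜 (Fin k)) (ReducedSpace G μ ξ),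
      IsSymplectic Ωbar ∧
      TwoForm.pullback (E := EuclideanSpace 𝕜 (Fin d)) (levelInclusion μ ξ) Ω =
        TwoForm.pullback (E := EuclideanSpace 𝕜 (Fin d)) (levelProjection G μ ξ) Ωbar := by
  refine ⟨hM.exists_manifold_structure_levelSet hfree, fun d _ _ hj k _ _ _ hπ => ?_⟩
  have hsurj : Function.Surjective (levelProjection G μ ξ) := Quotient.mk_surjective
  obtain ⟨Ωbar, hΩbar, huniq⟩ := existsUnique_eq_pullback hπ hsurj
    (hM.form_eq_zero_of_tderiv_levelProjection hfree hj hπ) fun p p' hpp' => by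
      obtain ⟨g, hg, h⟩ := levelProjection_eq_iff.1 hpp'.symm
      exact ⟨hM.levelTranslation ⟨g, hg⟩, hM.contMDiff_levelTranslation hj _, Subtype.ext h,
        hM.levelProjection_comp_levelTranslation _, hM.pullback_levelTranslation hj _⟩
  exact ⟨Ωbar, ⟨isSymplectic_of_pullback_eq hj.contMDiff hπ hsurj hM.symplectic hΩbar
    fun p v => hM.tderiv_levelProjection_eq_zero_of_form hfree hj hπ.contMDiff, hΩbar⟩,
    fun Ω' hΩ' => huniq Ω' hΩ'.2⟩
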